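/- Setting. Let $d=r+s$ and write $\mathbb{R}^d=\mathbb{R}^r\times\mathbb{R}^s$. Let $R$ be an expanding integer $d\times d$ matrix (all eigenvalues satisfy $|\lambda|>1$), $S:=R^T$, and let $B,L\subset\mathbb{Z}^d$ be finite with $0\in B$, $0\in L$. In general, $(R,B,L)$ is called a Hadamard triple if $\#L=\#B=:N$ and the matrix $N^{-1/2}\big(e^{2\pi i R^{-1}b\cdot l}\big)_{b\in B,\,l\in L}$ is unitary; assume that this holds. Let $\tau_b(x)=R^{-1}(x+b)$, $\sigma_l(x)=S^{-1}(x+l)$ and $W_B(x)=\big|\frac1N\sum_{b\in B}e^{2\pi i b\cdot x}\big|^2$. Let $\mu_B$ be the invariant measure of $(\tau_b)_{b\in B}$, i.e. the unique probability measure with $\int f\,d\mu_B=\frac1N\sum_{b\in B}\int f\circ\tau_b\,d\mu_B$ for all continuous $f$, and $\hat\mu_B(x)=\int e^{2\pi i t\cdot x}\,d\mu_B(t)$. A trajectory of $x$ is a set $\{\sigma_{\omega_n}\cdots\sigma_{\omega_1}x : n\ge1\}$ with $\omega\in L^{\mathbb{N}}$ and $W_B(\sigma_{\omega_n}\cdots\sigma_{\omega_1}x)\ne0$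 for all $n\ge 1$; the orbit of $x$ is the closure of the union of its trajectories; a closed set $F\subset\mathbb{R}^d$ is invariant if it contains the orbit of each of its points. For $x\in\mathbb{R}^d$ let $P_x$ be the unique probability measure on $L^{\mathbb{N}}$ with $P_x(\{\omega:\omega_1=l_1,\dots,\omega_n=l_n\})=\prod_{k=1}^nW_B(\sigma_{l_k}\cdots\sigma_{l_1}x)$ for all $n$ and $l_1,\dots,l_n\in L$, and let $N(F)$ be the set of $\omega\in L^{\mathbb N}$ with $\lim_n d(\sigma_{\omega_n}\cdots\sigma_{\omega_1}x,F)=0$ (this does not depend on $x$). An invariant set $F$ is spectral with spectrum $\Lambda\subset\mathbb{R}^d$ if $P_x(N(F))=\sum_{\lambda\in\Lambda}|\hat\mu_B(x+\lambda)|^2$ for all $x\in\mathbb{R}^d$. A vector $p\in\mathbb{R}^d$ is an $S$-period for $f$ if $f(x+S^np)=f(x)$ for all $x\in\mathbb{R}^d$ and $n\ge0$. Theorem. Let $y_0\in\mathbb{R}^s$ and suppose that $\mathbb{R}^r\times\{y_0\}$ is an invariant set. Then $\mathbb{R}^r\times\{0\}$ is invariant for the matrix $S$, so that $S=\begin{bmatrix}S_1&C\\0&S_2\end{bmatrix}$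 with $S_1$ of size $r\times r$, and there is $(l_1^0,l_2^0)\in L$ with $S_2^{-1}(y_0+l_2^0)=y_0$ (so $l_2^0=S_2y_0-y_0$ is determined by $y_0$). Let $A_1:=S_1^T$, let $\{r_1,\dots,r_{N_1}\}$ be the projection of $B$ to $\mathbb{Z}^r$, let $\mu_1$ be the invariant measure of the maps $\tau_{r_i}(x)=A_1^{-1}(x+r_i)$ on $\mathbb{R}^r$, and let $X_1=\{\sum_{k\ge1}A_1^{-k}r_{i_k}\}$ be their attractor. Let $\Lambda_1\subset\mathbb{R}^r$ and assume in addition: (a) $\mu_1\big(\tau_{r_i}(X_1)\cap\tau_{r_j}(X_1)\big)=0$ for all $i\ne j$; (b) the numbers $\#\{\eta:(r_i,\eta)\in B\}$, $1\le i\le N_1$, are all equal; (i) $\mu_1$ is spectral with spectrum $\Lambda_1$, i.e. $\{e^{2\pi i\lambda\cdot x}:\lambda\in\Lambda_1\}$ is an orthonormal basis of $L^2(\mu_1)$; (ii) $\Lambda_1\times\{-y_0\}\subset S(\Lambda_1\times\{-y_0\})+L$, and for every $\lambda_1\in\Lambda_1$ the vector $(\lambda_1,-y_0)$ is an $S$-period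 for $W_B$; (iii) $(A_1,\{r_1,\dots,r_{N_1}\},L_1(l_2^0))$ is a Hadamard triple, where $L_1(l_2^0)=\{l_1:(l_1,l_2^0)\in L\}$. Then $\mathbb{R}^r\times\{y_0\}$ is a spectral invariant set with spectrum $$\bigcup_{n\ge0}\big(L+SL+\dots+S^{n-1}L+S^n(\Lambda_1\times\{-y_0\})\big).$$ -/

import Mathlib

open MeasureTheory Filter Topology
open scoped Matrix ENNReal Pointwise

noncomputable section

namespace AffineIFS

section General

variable {ι : Type*} [Fintype ι] [DecidableEq ι]

/-- An integer matrix regarded as a real matrix. -/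
def realMat {κ : Type*} (M : Matrix κ κ ℤ) : Matrix κ κ ℝ := M.map (fun a => (a : ℝ))

/-- An integer vector regarded as a real vector. -/
def realVec {κ : Type*} (v : κ → ℤ) : κ → ℝ := fun i => (v i : ℝ)

/-- `R` is expanding: all its (complex) eigenvalues `z` satisfy `|z| > 1`. -/
def IsExpanding (R : Matrix ι ι ℤ) : Prop :=
  ∀ z ∈ spectrum ℂ (R.map (fun a => (a : ℂ))), 1 < ‖z‖

/-- The affine map `x ↦ M⁻¹ (x + v)`. With `M = R`, `v = b` this is `τ_b`;
with `M = Rᵀ = S`, `v = l` it is `σ_l`. -/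
def ifsMap (M : Matrix ι ι ℤ) (v : ι → ℤ) (x : ι → ℝ) : ι → ℝ :=
  (realMat M)⁻¹ *ᵥ (x + realVec v)

/-- The exponential function `e_p(x) = exp(2 π i p·x)`. -/
def expFun (p x : ι → ℝ) : ℂ :=
  Complex.exp (2 * Real.pi * Complex.I * ((p ⬝ᵥ x : ℝ) : ℂ))

/-- The Fourier transform `x ↦ ∫ exp(2 π i t·x) dμ(t)` of a measure. -/
def fourierTransform (μ : Measure (ι → ℝ)) (x : ι → ℝ) : ℂ := ∫ t, expFun t x ∂μ

/-- `Λ` is a spectrum for `μ`: the family `(e_p)_{p ∈ Λ}` is an orthonormal basis of `L²(μ)`. -/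
def IsSpectrum (μ : Measure (ι → ℝ)) (Λ : Set (ι → ℝ)) : Prop :=
  ∃ e : HilbertBasis Λ ℂ (Lp ℂ 2 μ), ∀ p : Λ, (e p : (ι → ℝ) → ℂ) =ᵐ[μ] expFun (p : ι → ℝ)

/-- The defining property of the invariant measure of the IFS `(τ_b)_{b ∈ B}`:
`μ` is a probability measure and `∫ f dμ = (1/N) ∑_b ∫ f ∘ τ_b dμ` for all continuous `f`. -/
def IsInvariantMeasure (R : Matrix ι ι ℤ) (B : Finset (ι → ℤ)) (μ : Measure (ι → ℝ)) : Prop :=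
  IsProbabilityMeasure μ ∧ ∀ f : (ι → ℝ) → ℂ, Continuous f →
    ∫ x, f x ∂μ = (1 / (B.card : ℂ)) * ∑ b ∈ B, ∫ x, f (ifsMap R b x) ∂μ

open Classical in
/-- The invariant measure `μ_B` of the IFS `(τ_b)_{b ∈ B}`. -/
def invariantMeasure (R : Matrix ι ι ℤ) (B : Finset (ι → ℤ)) : Measure (ι → ℝ) :=
  if h : ∃ μ, IsInvariantMeasure R B μ then h.choose else 0

/-- The attractor `{∑_{k ≥ 1} R⁻ᵏ b_k | b_k ∈ B}` of the IFS `(τ_b)_{b ∈ B}`. -/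
def attractor (R : Matrix ι ι ℤ) (B : Finset (ι → ℤ)) : Set (ι → ℝ) :=
  {x | ∃ b : ℕ → (ι → ℤ), (∀ k, b k ∈ B) ∧
    HasSum (fun k : ℕ => ((realMat R)⁻¹ ^ (k + 1)) *ᵥ realVec (b k)) x}

/-- The invariant measure has no overlap. -/
def NoOverlap (R : Matrix ι ι ℤ) (B : Finset (ι → ℤ)) : Prop :=
  ∀ b ∈ B, ∀ b' ∈ B, b ≠ b' →
    invariantMeasure R B (ifsMap R b '' attractor R B ∩ ifsMap R b' '' attractor R B) = 0

/-- The matrix `N^{-1/2} (exp(2 π i R⁻¹b·l))_{b ∈ B, l ∈ L}`, `N = #B`. -/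
def hadamardMatrix (R : Matrix ι ι ℤ) (B L : Finset (ι → ℤ)) : Matrix B L ℂ :=
  Matrix.of fun b l => ((1 / Real.sqrt (B.card : ℝ) : ℝ) : ℂ) *
    expFun ((realMat R)⁻¹ *ᵥ realVec (b : ι → ℤ)) (realVec (l : ι → ℤ))

/-- `(R, B, L)` is a Hadamard triple: `#L = #B` and the above matrix is unitary. -/
def IsHadamardTriple (R : Matrix ι ι ℤ) (B L : Finset (ι → ℤ)) : Prop :=
  L.card = B.card ∧
    hadamardMatrix R B L * (hadamardMatrix R B L)ᴴ = 1 ∧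
    (hadamardMatrix R B L)ᴴ * hadamardMatrix R B L = 1

/-- `W_B(x) = |(1/N) ∑_{b ∈ B} exp(2 π i b·x)|²`. -/
def W (B : Finset (ι → ℤ)) (x : ι → ℝ) : ℝ :=
  ‖(1 / (B.card : ℂ)) * ∑ b ∈ B, expFun (realVec b) x‖ ^ 2

/-- `sigmaPath R ω x n = σ_{ω_n} ⋯ σ_{ω_1} x`, where `ω_k` is written `ω (k - 1)`. -/
def sigmaPath (R : Matrix ι ι ℤ) {L : Finset (ι → ℤ)} (ω : ℕ → L) (x : ι → ℝ) : ℕ → (ι → ℝ)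
  | 0 => x
  | n + 1 => ifsMap Rᵀ (ω n : ι → ℤ) (sigmaPath R ω x n)

/-- The orbit of `x`: the closure of the union of all trajectories of `x`. -/
def orbit (R : Matrix ι ι ℤ) (B L : Finset (ι → ℤ)) (x : ι → ℝ) : Set (ι → ℝ) :=
  closure {z | ∃ ω : ℕ → L, (∀ n, 1 ≤ n → W B (sigmaPath R ω x n) ≠ 0) ∧
    ∃ n, 1 ≤ n ∧ z = sigmaPath R ω x n}

/-- A closed set is invariant if it contains the orbit of all of its points. -/
def IsInvariantSet (R : Matrix ι ι ℤ) (B L : Finset (ι → ℤ)) (F : Set (ι → ℝ)) : Prop :=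
  IsClosed F ∧ ∀ x ∈ F, orbit R B L x ⊆ F

/-- The defining property of the path measure `P_x` on the space `Ω = L^ℕ` of infinite words:
the cylinder of the words starting with `ω_1 … ω_n` has measure
`∏_{k=1}^n W_B(σ_{ω_k} ⋯ σ_{ω_1} x)`. -/
def IsPathMeasure (R : Matrix ι ι ℤ) (B L : Finset (ι → ℤ)) (x : ι → ℝ)
    (P : Measure (ℕ → L)) : Prop :=
  IsProbabilityMeasure P ∧ ∀ (ω : ℕ → L) (n : ℕ),
    P {ω' | ∀ k < n, ω' k = ω k} =
      ENNReal.ofReal (∏ k ∈ Finset.range n, W B (sigmaPath R ω x (k + 1)))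

open Classical in
/-- The path measure `P_x`. -/
def pathMeasure (R : Matrix ι ι ℤ) (B L : Finset (ι → ℤ)) (x : ι → ℝ) : Measure (ℕ → L) :=
  if h : ∃ P, IsPathMeasure R B L x P then h.choose else 0

/-- `N(F)`: the words `ω` with `d(σ_{ω_n} ⋯ σ_{ω_1} x, F) → 0`, where `d` is the Euclidean
distance (for an expanding `R` this condition does not depend on the point `x`). -/
def wordsTo (R : Matrix ι ι ℤ) (L : Finset (ι → ℤ)) (F : Set (ι → ℝ)) : Set (ℕ → L) :=
  {ω | ∀ x : ι → ℝ, Tendsto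
    (fun n => Metric.infEDist (WithLp.toLp 2 (sigmaPath R ω x n) : EuclideanSpace ℝ ι)
      (WithLp.toLp 2 '' F)) atTop (𝓝 0)}

/-- `F` is a spectral invariant set with spectrum `Λ`: it is a closed invariant set and
`P_x(N(F)) = ∑_{p ∈ Λ} |μ̂_B(x + p)|²` for all `x`. -/
def IsSpectralSet (R : Matrix ι ι ℤ) (B L : Finset (ι → ℤ)) (F Λ : Set (ι → ℝ)) : Prop :=
  IsInvariantSet R B L F ∧ ∀ x : ι → ℝ,
    pathMeasure R B L x (wordsTo R L F) =
      ∑' p : Λ, ‖fourierTransform (invariantMeasure R B) (x + (p : ι → ℝ))‖ₑ ^ 2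

/-- `p` is an `S`-period for `f`, with `S = Rᵀ`: `f(x + Sⁿp) = f(x)` for all `x` and `n ≥ 0`. -/
def IsSPeriod (R : Matrix ι ι ℤ) (f : (ι → ℝ) → ℝ) (p : ι → ℝ) : Prop :=
  ∀ (x : ι → ℝ) (n : ℕ), f (x + (realMat Rᵀ ^ n) *ᵥ p) = f x

/-- The set `⋃_n (L + S L + ⋯ + S^{n-1} L + Sⁿ Γ)`, with `S = Rᵀ`. -/
def generatedSet (R : Matrix ι ι ℤ) (L : Finset (ι → ℤ)) (Γ : Set (ι → ℝ)) : Set (ι → ℝ) :=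
  ⋃ n : ℕ, {v | ∃ l : Fin n → (ι → ℤ), (∀ k, l k ∈ L) ∧ ∃ p ∈ Γ,
    v = ∑ k : Fin n, (realMat Rᵀ ^ (k : ℕ)) *ᵥ realVec (l k) + (realMat Rᵀ ^ n) *ᵥ p}

end General

section Existence

variable {ι : Type*} [Fintype ι] [DecidableEq ι]

section Norms

attribute [local instance] Matrix.linftyOpNormedRing Matrix.linftyOpNormedAlgebra
  Matrix.linftyOpNormedAddCommGroup

lemma summable_norm_inv_pow (A : Matrix ι ι ℂ) (hA : ∀ z ∈ spectrum ℂ A, 1 < ‖z‖) :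
    Summable fun k : ℕ => ‖A⁻¹ ^ k‖ := by
  cases isEmpty_or_nonempty ι
  · have : ∀ k : ℕ, ‖A⁻¹ ^ k‖ = 0 := fun k => by
      rw [Subsingleton.elim (A⁻¹ ^ k) 0, norm_zero]
    simp only [this]
    exact summable_zero
  have h0 : IsUnit A := by
    by_contra h
    have : (0 : ℂ) ∈ spectrum ℂ A := (spectrum.zero_mem_iff ℂ).2 h
    have := hA 0 this
    simp at this
    linarith
  have hdet : IsUnit A.det := (Matrix.isUnit_iff_isUnit_det A).1 h0
  have hspec : ∀ z ∈ spectrum ℂ A⁻¹, ‖z‖₊ < 1 := by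
    intro z hz
    have hz0 : z ≠ 0 := by
      rintro rfl
      exact spectrum.zero_notMem ℂ (Matrix.isUnit_nonsing_inv_iff.2 h0) hz
    have h1 : z⁻¹ ∈ spectrum ℂ A := by
      have hu : (h0.unit⁻¹ : (Matrix ι ι ℂ)ˣ).val = A⁻¹ := by
        rw [Matrix.coe_units_inv]; rfl
      rw [← hu, ← Units.val_mk0 hz0] at hz
      have := spectrum.inv_mem_iff.1 hz
      simpa using this
    have h2 := hA _ h1
    rw [norm_inv] at h2
    have h3 : 0 < ‖z‖ := norm_pos_iff.2 hz0
    have h4 : ‖z‖ < 1 := by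
      by_contra h
      push Not at h
      have := inv_le_one_of_one_le₀ h
      linarith
    exact_mod_cast h4
  have hr : spectralRadius ℂ A⁻¹ < ((1 : NNReal) : ℝ≥0∞) :=
    spectrum.spectralRadius_lt_of_forall_lt A⁻¹ hspec
  obtain ⟨c, hc1, hc2⟩ := ENNReal.lt_iff_exists_nnreal_btwn.1 hr
  have hc2' : c < 1 := by exact_mod_cast hc2
  have hev := (spectrum.pow_nnnorm_pow_one_div_tendsto_nhds_spectralRadius A⁻¹).eventually
    (gt_mem_nhds hc1)
  have hgeo : Summable fun k : ℕ => ((c : ℝ)) ^ k :=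
    summable_geometric_of_lt_one c.2 (by exact_mod_cast hc2')
  refine Summable.of_norm_bounded_eventually_nat hgeo ?_
  filter_upwards [hev, eventually_gt_atTop 0] with n hn hn0
  have h5 : ((‖A⁻¹ ^ n‖₊ : ℝ≥0∞) ^ (1 / n : ℝ)) ^ (n : ℝ) ≤ (c : ℝ≥0∞) ^ (n : ℝ) :=
    ENNReal.rpow_le_rpow hn.le (by positivity)
  rw [← ENNReal.rpow_mul, one_div, inv_mul_cancel₀ (by positivity), ENNReal.rpow_one,
    ENNReal.rpow_natCast] at h5
  rw [norm_norm]
  exact_mod_cast h5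

lemma summable_entries (R : Matrix ι ι ℤ) (hR : IsExpanding R) (i j : ι) :
    Summable fun k : ℕ => ‖((realMat R)⁻¹ ^ k) i j‖ := by
  have hA := summable_norm_inv_pow _ hR
  refine Summable.of_nonneg_of_le (fun _ => norm_nonneg _) (fun k => ?_) hA
  have h1 : R.map (fun a => (a : ℂ)) = (Complex.ofRealHom.mapMatrix (realMat R)) := by
    ext a b; simp [realMat]
  have hdet : IsUnit (realMat R).det := by
    have h0 : IsUnit (R.map (fun a => (a : ℂ))) := by
      by_contra h
      have := hR 0 ((spectrum.zero_mem_iff ℂ).2 h)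
      simp at this
      linarith
    rw [h1, Matrix.isUnit_iff_isUnit_det, ← RingHom.map_det, isUnit_iff_ne_zero] at h0
    rw [isUnit_iff_ne_zero]
    intro h
    rw [h] at h0
    simp at h0
  have h2 : (R.map (fun a => (a : ℂ)))⁻¹ = Complex.ofRealHom.mapMatrix (realMat R)⁻¹ := by
    rw [h1]
    apply Matrix.inv_eq_right_inv
    rw [← map_mul, Matrix.mul_nonsing_inv _ hdet, map_one]
  rw [h2, ← map_pow]
  set M := (realMat R)⁻¹ ^ k
  have h3 : ‖M i j‖ = ‖(Complex.ofRealHom.mapMatrix M) i j‖ := by simp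
  rw [h3, Matrix.linfty_opNorm_def]
  have h4 : ‖(Complex.ofRealHom.mapMatrix M) i j‖₊ ≤
      ∑ j, ‖(Complex.ofRealHom.mapMatrix M) i j‖₊ :=
    Finset.single_le_sum (f := fun j => ‖(Complex.ofRealHom.mapMatrix M) i j‖₊)
      (fun _ _ => zero_le) (Finset.mem_univ j)
  have h5 := Finset.le_sup (f := fun i => ∑ j, ‖(Complex.ofRealHom.mapMatrix M) i j‖₊)
    (Finset.mem_univ i)
  exact_mod_cast h4.trans h5

end Norms

/-- The coding map `ω ↦ ∑_{k ≥ 1} R⁻ᵏ b_k`. -/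
def coding (R : Matrix ι ι ℤ) {B : Finset (ι → ℤ)} (ω : ℕ → B) : ι → ℝ :=
  fun i => ∑' k : ℕ, (((realMat R)⁻¹ ^ (k + 1)) *ᵥ realVec (ω k : ι → ℤ)) i

lemma coding_bound (R : Matrix ι ι ℤ) (hR : IsExpanding R) (B : Finset (ι → ℤ)) (i : ι) :
    ∃ u : ℕ → ℝ, Summable u ∧ ∀ (ω : ℕ → B) (k : ℕ),
      ‖(((realMat R)⁻¹ ^ (k + 1)) *ᵥ realVec (ω k : ι → ℤ)) i‖ ≤ u k := by
  refine ⟨fun k => ∑ j, ‖((realMat R)⁻¹ ^ (k + 1)) i j‖ * ∑ b ∈ B, ‖realVec b j‖, ?_, ?_⟩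
  · refine summable_sum fun j _ => Summable.mul_right _ ?_
    exact (summable_nat_add_iff 1).2 (summable_entries R hR i j)
  · intro ω k
    refine (norm_sum_le _ _).trans (Finset.sum_le_sum fun j _ => ?_)
    rw [norm_mul]
    refine mul_le_mul_of_nonneg_left ?_ (norm_nonneg _)
    exact Finset.single_le_sum (f := fun b => ‖realVec b j‖) (fun _ _ => norm_nonneg _) (ω k).2

lemma coding_hasSum (R : Matrix ι ι ℤ) (hR : IsExpanding R) {B : Finset (ι → ℤ)} (ω : ℕ → B) :
    HasSum (fun k : ℕ => ((realMat R)⁻¹ ^ (k + 1)) *ᵥ realVec (ω k : ι → ℤ)) (coding R ω) := by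
  rw [Pi.hasSum]
  intro i
  obtain ⟨u, hu, hb⟩ := coding_bound R hR B i
  exact (Summable.of_norm_bounded hu (hb ω)).hasSum

lemma continuous_coding (R : Matrix ι ι ℤ) (hR : IsExpanding R) (B : Finset (ι → ℤ)) :
    Continuous (coding R : (ℕ → B) → ι → ℝ) := by
  refine continuous_pi fun i => ?_
  obtain ⟨u, hu, hb⟩ := coding_bound R hR B i
  refine continuous_tsum (fun k => ?_) hu (fun k ω => hb ω k)
  have h : Continuous fun b : B => (((realMat R)⁻¹ ^ (k + 1)) *ᵥ realVec (b : ι → ℤ)) i :=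
    continuous_of_discreteTopology
  exact h.comp (continuous_apply k)

/-- Prefix a word by a letter. -/
def consWord {α : Type*} (b : α) (ω : ℕ → α) : ℕ → α
  | 0 => b
  | n + 1 => ω n

lemma coding_consWord (R : Matrix ι ι ℤ) (hR : IsExpanding R) {B : Finset (ι → ℤ)} (b : B)
    (ω : ℕ → B) : coding R (consWord b ω) = ifsMap R (b : ι → ℤ) (coding R ω) := by
  have h1 := coding_hasSum R hR (consWord b ω)
  have h2 : HasSum (fun k : ℕ => (realMat R)⁻¹ *ᵥ
      (((realMat R)⁻¹ ^ (k + 1)) *ᵥ realVec (ω k : ι → ℤ))) ((realMat R)⁻¹ *ᵥ coding R ω) :=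
    (coding_hasSum R hR ω).mapL (LinearMap.toContinuousLinearMap (Matrix.mulVecLin (realMat R)⁻¹))
  have h3 : HasSum (fun k : ℕ => ((realMat R)⁻¹ ^ (k + 1)) *ᵥ realVec ((consWord b ω k : B) : ι → ℤ))
      ((realMat R)⁻¹ *ᵥ realVec (b : ι → ℤ) + (realMat R)⁻¹ *ᵥ coding R ω) := by
    rw [← hasSum_nat_add_iff' 1]
    simp only [Matrix.mulVec_mulVec, ← pow_succ'] at h2
    simpa only [consWord, Finset.sum_range_one, zero_add, pow_one, add_sub_cancel_left] using h2
  rw [h1.unique h3, ifsMap, Matrix.mulVec_add, add_comm]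

lemma measurable_consWord {α : Type*} [MeasurableSpace α] :
    Measurable fun p : α × (ℕ → α) => consWord p.1 p.2 := by
  refine measurable_pi_iff.2 fun n => ?_
  cases n with
  | zero => exact measurable_fst
  | succ n => exact (measurable_pi_apply n).comp measurable_snd

lemma map_consWord {α : Type*} [MeasurableSpace α] (u : Measure α) [IsProbabilityMeasure u] :
    (u.prod (Measure.infinitePi fun _ : ℕ => u)).map (fun p => consWord p.1 p.2) =
      Measure.infinitePi fun _ : ℕ => u := by
  classical
  refine Measure.eq_infinitePi _ fun s t ht => ?_
  rw [Measure.map_apply measurable_consWord (MeasurableSet.pi s.countable_toSet fun i _ => ht i)]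
  have h1 : (fun p : α × (ℕ → α) => consWord p.1 p.2) ⁻¹' (Set.pi s t) =
      (if 0 ∈ s then t 0 else Set.univ) ×ˢ
        Set.pi ((s.preimage Nat.succ (Nat.succ_injective.injOn) : Finset ℕ) : Set ℕ)
          (fun k => t (k + 1)) := by
    ext ⟨a, ω⟩
    simp only [Set.mem_preimage, Set.mem_pi, Set.mem_prod, Finset.mem_coe, Finset.mem_preimage]
    constructor
    · intro h
      refine ⟨?_, fun k hk => h (k + 1) hk⟩
      split_ifs with h0
      · exact h 0 h0
      · trivial
    · rintro ⟨h0, h⟩ k hk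
      cases k with
      | zero => rw [if_pos hk] at h0; exact h0
      | succ k => exact h k hk
  rw [h1, Measure.prod_prod, Measure.infinitePi_pi _ (fun i _ => ht _)]
  have h2 : ∏ i ∈ s.preimage Nat.succ (Nat.succ_injective.injOn), u (t (i + 1)) =
      ∏ i ∈ s.erase 0, u (t i) := by
    refine Finset.prod_bij (fun i _ => i + 1) ?_ ?_ ?_ ?_
    · intro i hi; simpa using hi
    · intro i _ j _ h; simpa using h
    · intro j hj
      obtain ⟨h0, hj⟩ := Finset.mem_erase.1 hj
      obtain ⟨k, rfl⟩ := Nat.exists_eq_succ_of_ne_zero h0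
      exact ⟨k, by simpa using hj, rfl⟩
    · intro i _; rfl
  rw [h2]
  split_ifs with h0
  · rw [Finset.mul_prod_erase s (fun i => u (t i)) h0]
  · rw [measure_univ, one_mul, Finset.erase_eq_of_notMem h0]

/-- Existence of the invariant measure. -/
theorem exists_isInvariantMeasure (R : Matrix ι ι ℤ) (hR : IsExpanding R) (B : Finset (ι → ℤ))
    (hB : B.Nonempty) : ∃ μ, IsInvariantMeasure R B μ := by
  have : Nonempty B := hB.to_subtype
  let u : Measure B := (PMF.uniformOfFintype B).toMeasure
  let ν : Measure (ℕ → B) := Measure.infinitePi fun _ : ℕ => u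
  have hc := continuous_coding R hR B
  refine ⟨ν.map (coding R), Measure.isProbabilityMeasure_map hc.measurable.aemeasurable, ?_⟩
  intro f hf
  have hi : ∀ g : (ι → ℝ) → ℂ, Continuous g →
      ∫ x, g x ∂(ν.map (coding R)) = ∫ ω, g (coding R ω) ∂ν := fun g hg =>
    integral_map hc.measurable.aemeasurable hg.aestronglyMeasurable
  have hτ : ∀ b : ι → ℤ, Continuous (ifsMap R b) := fun b => by
    unfold ifsMap
    exact Continuous.matrix_mulVec continuous_const (by fun_prop)
  rw [hi f hf]
  have hg : Continuous fun ω : ℕ → B => f (coding R ω) := hf.comp hc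
  have h1 : ∫ ω, f (coding R ω) ∂ν =
      ∫ p : B × (ℕ → B), f (coding R (consWord p.1 p.2)) ∂(u.prod ν) := by
    conv_lhs => rw [show ν = (u.prod ν).map (fun p => consWord p.1 p.2) from
      (map_consWord u).symm]
    exact integral_map measurable_consWord.aemeasurable hg.aestronglyMeasurable
  have hint : Integrable (fun p : B × (ℕ → B) => f (coding R (consWord p.1 p.2)))
      (u.prod ν) := by
    obtain ⟨C, hC⟩ := (isCompact_range hg).isBounded.exists_norm_le
    refine Integrable.of_bound
      (hg.measurable.comp measurable_consWord).aestronglyMeasurable C ?_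
    exact Eventually.of_forall fun p => hC _ ⟨_, rfl⟩
  rw [h1, integral_prod _ hint, PMF.integral_eq_sum]
  simp only [PMF.uniformOfFintype_apply, Fintype.card_coe, coding_consWord R hR]
  rw [← Finset.smul_sum, ← Finset.sum_coe_sort B]
  simp only [fun b : B => hi (fun x => f (ifsMap R b x)) (hf.comp (hτ b))]
  rw [Complex.real_smul]
  simp

theorem isInvariantMeasure_invariantMeasure (R : Matrix ι ι ℤ) (hR : IsExpanding R)
    (B : Finset (ι → ℤ)) (hB : B.Nonempty) : IsInvariantMeasure R B (invariantMeasure R B) := by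
  have h := exists_isInvariantMeasure R hR B hB
  rw [invariantMeasure, dif_pos h]
  exact h.choose_spec

lemma expFun_add {κ : Type*} [Fintype κ] (p x y : κ → ℝ) : expFun p (x + y) = expFun p x * expFun p y := by
  rw [expFun, expFun, expFun, ← Complex.exp_add, dotProduct_add]
  push_cast
  ring_nf

lemma norm_expFun {κ : Type*} [Fintype κ] (p x : κ → ℝ) : ‖expFun p x‖ = 1 := by
  rw [expFun, show (2 * Real.pi * Complex.I * ((p ⬝ᵥ x : ℝ) : ℂ)) =
    ((2 * Real.pi * (p ⬝ᵥ x) : ℝ) : ℂ) * Complex.I by push_cast; ring]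
  exact Complex.norm_exp_ofReal_mul_I _

/-- `∑_l W_B(σ_l(x)) = 1`. -/
lemma sum_W_ifsMap (R : Matrix ι ι ℤ) (B L : Finset (ι → ℤ)) (hB : B.Nonempty)
    (h : IsHadamardTriple R B L) (x : ι → ℝ) :
    ∑ l : L, W B (ifsMap Rᵀ (l : ι → ℤ) x) = 1 := by
  have hN : (0 : ℝ) < B.card := by exact_mod_cast hB.card_pos
  set H := hadamardMatrix R B L with hH
  set c : B → ℂ := fun b => expFun (realVec (b : ι → ℤ)) ((realMat Rᵀ)⁻¹ *ᵥ x) with hc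
  have hT : (realMat Rᵀ)⁻¹ = ((realMat R)⁻¹)ᵀ := by
    rw [Matrix.transpose_nonsing_inv]; rfl
  have h1 : ∀ l : L, W B (ifsMap Rᵀ (l : ι → ℤ) x) = (1 / (B.card : ℝ)) * ‖(c ᵥ* H) l‖ ^ 2 := by
    intro l
    have h2 : (c ᵥ* H) l = ((1 / Real.sqrt (B.card : ℝ) : ℝ) : ℂ) *
        ∑ b ∈ B, expFun (realVec b) (ifsMap Rᵀ (l : ι → ℤ) x) := by
      rw [← Finset.sum_coe_sort B, Finset.mul_sum]
      refine Finset.sum_congr rfl fun b _ => ?_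
      rw [ifsMap, Matrix.mulVec_add, expFun_add]
      change c b * (((1 / Real.sqrt (B.card : ℝ) : ℝ) : ℂ) *
        expFun ((realMat R)⁻¹ *ᵥ realVec (b : ι → ℤ)) (realVec (l : ι → ℤ))) = _
      have : expFun ((realMat R)⁻¹ *ᵥ realVec (b : ι → ℤ)) (realVec (l : ι → ℤ)) =
          expFun (realVec (b : ι → ℤ)) ((realMat Rᵀ)⁻¹ *ᵥ realVec (l : ι → ℤ)) := by
        rw [expFun, expFun, hT, Matrix.mulVec_transpose, dotProduct_comm,
          Matrix.dotProduct_mulVec, dotProduct_comm]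
      rw [this, hc]
      ring
    rw [h2, W, norm_mul, norm_mul, mul_pow, mul_pow, ← mul_assoc]
    congr 1
    rw [Complex.norm_real, Real.norm_eq_abs, sq_abs, div_pow, Real.sq_sqrt hN.le]
    simp
    field_simp
  have h3 : ∑ l : L, ‖(c ᵥ* H) l‖ ^ 2 = B.card := by
    have h4 : ((c ᵥ* H) ⬝ᵥ star (c ᵥ* H)) = (B.card : ℂ) := by
      rw [Matrix.star_vecMul, Matrix.dotProduct_mulVec, Matrix.vecMul_vecMul, h.2.1,
        Matrix.vecMul_one]
      simp only [dotProduct, Pi.star_apply, RCLike.star_def, Complex.mul_conj,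
        Complex.normSq_eq_norm_sq]
      simp [hc, norm_expFun]
    have h5 : ((c ᵥ* H) ⬝ᵥ star (c ᵥ* H)) = ((∑ l : L, ‖(c ᵥ* H) l‖ ^ 2 : ℝ) : ℂ) := by
      simp only [dotProduct, Pi.star_apply, RCLike.star_def, Complex.mul_conj,
        Complex.normSq_eq_norm_sq]
      push_cast
      rfl
    rw [h4] at h5
    exact_mod_cast h5.symm
  simp only [h1]
  rw [← Finset.mul_sum, h3]
  field_simp

/-- Existence of the path measures. -/
theorem exists_isPathMeasure (R : Matrix ι ι ℤ) (B L : Finset (ι → ℤ)) (hB : B.Nonempty)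
    (h : IsHadamardTriple R B L) (x : ι → ℝ) : ∃ P, IsPathMeasure R B L x P := by
  classical
  have hW : ∀ y, 0 ≤ W B y := fun y => by unfold W; positivity
  have hLne : L.Nonempty := by
    rw [← Finset.card_pos, h.1]; exact hB.card_pos
  have : Nonempty L := hLne.to_subtype
  -- the law of the next letter, from the point `y`
  let step : (ι → ℝ) → PMF L := fun y =>
    PMF.ofFintype (fun l => ENNReal.ofReal (W B (ifsMap Rᵀ (l : ι → ℤ) y))) (by
      rw [← ENNReal.ofReal_sum_of_nonneg (fun _ _ => hW _), sum_W_ifsMap R B L hB h,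
        ENNReal.ofReal_one])
  -- extend a finite history to an infinite word
  let ext : (n : ℕ) → (Finset.Iic n → L) → ℕ → L := fun n w k =>
    if hk : k ≤ n then w ⟨k, Finset.mem_Iic.2 hk⟩ else Classical.arbitrary L
  let κ : (n : ℕ) → ProbabilityTheory.Kernel (Finset.Iic n → L) L := fun n =>
    { toFun := fun w => (step (sigmaPath R (ext n w) x (n + 1))).toMeasure
      measurable' := measurable_of_countable _ }
  have hκ : ∀ n, ProbabilityTheory.IsMarkovKernel (κ n) := fun n =>
    ⟨fun w => PMF.toMeasure.isProbabilityMeasure _⟩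
  have hloc : ∀ (ω ω' : ℕ → L) (n : ℕ), (∀ k < n, ω k = ω' k) →
      sigmaPath R ω x n = sigmaPath R ω' x n := by
    intro ω ω' n
    induction n with
    | zero => intro _; rfl
    | succ n ih =>
      intro hk
      rw [sigmaPath, sigmaPath, ih fun k hkn => hk k (by omega), hk n (by omega)]
  let μ₀ : Measure L := (step x).toMeasure
  have hμ₀ : IsProbabilityMeasure μ₀ := PMF.toMeasure.isProbabilityMeasure _
  let P : Measure (ℕ → L) := ProbabilityTheory.Kernel.trajMeasure (X := fun _ => L) μ₀ κ
  have hP : IsProbabilityMeasure P := by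
    change IsProbabilityMeasure (ProbabilityTheory.Kernel.trajMeasure (X := fun _ => L) μ₀ κ)
    infer_instance
  refine ⟨P, hP, fun ω n => ?_⟩
  cases n with
  | zero => simp
  | succ n =>
  induction n with
  | zero =>
    have hmap : P.map (Preorder.frestrictLe (π := fun _ => L) 0) =
        μ₀.map (MeasurableEquiv.piUnique (fun _ : Finset.Iic 0 => L)).symm := by
      change (ProbabilityTheory.Kernel.trajMeasure (X := fun _ => L) μ₀ κ).map _ = _
      rw [ProbabilityTheory.Kernel.trajMeasure, Measure.map_comp _ _ (by fun_prop),
        ProbabilityTheory.Kernel.traj_map_frestrictLe,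
        ProbabilityTheory.Kernel.partialTraj_self, Measure.id_comp]
    have hset : {ω' : ℕ → L | ∀ k < 0 + 1, ω' k = ω k} =
        (Preorder.frestrictLe (π := fun _ => L) 0) ⁻¹' {w | w default = ω 0} := by
      ext ω'
      simp only [Set.mem_ofPred_eq, Set.mem_preimage]
      constructor
      · intro hk
        exact hk 0 (by omega)
      · intro h1 k hk
        obtain rfl : k = 0 := by omega
        exact h1
    have hms : MeasurableSet {w : Finset.Iic 0 → L | w default = ω 0} :=
      (Set.toFinite _).measurableSet
    rw [hset, ← Measure.map_apply (by fun_prop) hms, hmap,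
      Measure.map_apply (by fun_prop) hms]
    have hpre : (MeasurableEquiv.piUnique (fun _ : Finset.Iic 0 => L)).symm ⁻¹'
        {w : Finset.Iic 0 → L | w default = ω 0} = {ω 0} := by
      ext l
      simp [MeasurableEquiv.piUnique]
    rw [hpre, PMF.toMeasure_apply_singleton _ _ (measurableSet_singleton _)]
    simp [step, sigmaPath]
  | succ n ih =>
    have hkey := ProbabilityTheory.Kernel.map_frestrictLe_trajMeasure_compProd_eq_map_trajMeasure
      (X := fun _ => L) (μ₀ := μ₀) (κ := κ) (a := n)
    have hset : {ω' : ℕ → L | ∀ k < n + 1 + 1, ω' k = ω k} =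
        (fun z : ℕ → L => (Preorder.frestrictLe (π := fun _ => L) n z, z (n + 1))) ⁻¹'
          ({(fun k => ω k : Finset.Iic n → L)} ×ˢ {ω (n + 1)}) := by
      ext ω'
      simp only [Set.mem_ofPred_eq, Set.mem_preimage, Set.mem_prod, Set.mem_singleton_iff,
        funext_iff]
      constructor
      · intro hk
        exact ⟨fun k => hk k (by have := Finset.mem_Iic.1 k.2; omega), hk _ (by omega)⟩
      · rintro ⟨h1, h2⟩ k hk
        rcases Nat.lt_succ_iff_lt_or_eq.1 hk with hk | rfl
        · exact h1 ⟨k, Finset.mem_Iic.2 (by omega)⟩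
        · exact h2
    have hset' : {ω' : ℕ → L | ∀ k < n + 1, ω' k = ω k} =
        (Preorder.frestrictLe (π := fun _ => L) n) ⁻¹' {(fun k => ω k : Finset.Iic n → L)} := by
      ext ω'
      simp only [Set.mem_ofPred_eq, Set.mem_preimage, Set.mem_singleton_iff, funext_iff]
      constructor
      · intro hk k
        exact hk k (by have := Finset.mem_Iic.1 k.2; omega)
      · intro h1 k hk
        exact h1 ⟨k, Finset.mem_Iic.2 (by omega)⟩
    rw [hset, ← Measure.map_apply (by fun_prop) (measurableSet_singleton _ |>.prod
      (measurableSet_singleton _)), ← hkey, Measure.compProd_apply_prod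
      (measurableSet_singleton _) (measurableSet_singleton _), lintegral_singleton]
    rw [Measure.map_apply (by fun_prop) (measurableSet_singleton _), ← hset', ih,
      Finset.prod_range_succ _ (n + 1), mul_comm,
      ENNReal.ofReal_mul (Finset.prod_nonneg fun _ _ => hW _)]
    congr 1
    change (step _).toMeasure {ω (n + 1)} = _
    rw [PMF.toMeasure_apply_singleton _ _ (measurableSet_singleton _)]
    change ENNReal.ofReal (W B (ifsMap Rᵀ (ω (n + 1) : ι → ℤ) (sigmaPath R _ x (n + 1)))) =
      ENNReal.ofReal (W B (ifsMap Rᵀ (ω (n + 1) : ι → ℤ) (sigmaPath R ω x (n + 1))))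
    rw [hloc _ ω (n + 1) (fun k hk => ?_)]
    simp only [ext]
    rw [dif_pos (by omega)]

theorem isPathMeasure_pathMeasure (R : Matrix ι ι ℤ) (B L : Finset (ι → ℤ)) (hB : B.Nonempty)
    (h : IsHadamardTriple R B L) (x : ι → ℝ) :
    IsPathMeasure R B L x (pathMeasure R B L x) := by
  have h' := exists_isPathMeasure R B L hB h x
  rw [pathMeasure, dif_pos h']
  exact h'.choose_spec

end Existence

section Blocks

/-! `ℝ^d` with `d = r + s` is `Fin r ⊕ Fin s → ℝ`, and `(x, y)` is `Sum.elim x y`. -/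

variable {r s : ℕ}

/-- The product set `Γ × {y} ⊆ ℝ^r × ℝ^s`. -/
def timesPoint (Γ : Set (Fin r → ℝ)) (y : Fin s → ℝ) : Set (Fin r ⊕ Fin s → ℝ) :=
  (fun x => Sum.elim x y) '' Γ

/-- The projection `{r_1, …, r_{N_1}}` of `B` onto the first `r` coordinates. -/
def projFst (B : Finset (Fin r ⊕ Fin s → ℤ)) : Finset (Fin r → ℤ) :=
  B.image fun b => b ∘ Sum.inl

/-- The number `N_2(i)` of the `η` with `(r_i, η) ∈ B`, for `ρ = r_i`. -/
def fibreCard (B : Finset (Fin r ⊕ Fin s → ℤ)) (ρ : Fin r → ℤ) : ℕ :=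
  (B.filter fun b => b ∘ Sum.inl = ρ).card

/-- `L_1(l₂) = {l₁ | (l₁, l₂) ∈ L}`. -/
def rowSet (L : Finset (Fin r ⊕ Fin s → ℤ)) (l₂ : Fin s → ℤ) : Finset (Fin r → ℤ) :=
  (L.filter fun l => l ∘ Sum.inr = l₂).image fun l => l ∘ Sum.inl

end Blocks

end AffineIFS

end

/-! Write Γ = Λ₁ × {-y₀} and F = ℝ^r × {y₀}. A word ω codes p when p = ω₁ + Sω₂ + ⋯ + S^{n-1}ω_n +
Sⁿq_n with q_n ∈ Γ for all large n. Since `W B` has ℤ^d-periods and the vectors of Γ are S-periods,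
W_B(σ_{ω_j}⋯σ_{ω_1}x) = W_B(S^{-j}(x + p)). The infinite product of these factors gives P_x({ω}) =
|μ̂_B(x + p)|² (`Codes.pathMeasure_singleton`).

Coding is a bijection between coded words and the generated set. Inclusion (ii) supplies a word for
each p. That word is unique because P_{-p} gives it mass |μ̂_B(0)|² = 1 (`Codes.word_unique`). A
word codes only one point because two would differ by Sⁿ(q - q') with μ̂_B(q - q') = 0, while
μ̂_B(S^{-n}(p - p')) → μ̂_B(0) = 1 (`Codes.point_unique`). Hence the countable set C of coded words
has P_x(C) equal to the desired sum, and it remains to prove P_x(N(F)) = P_x(C).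

Words in N(F) are those whose second components are eventually l₂⁰ (`wordsTo_timesPoint`), so C ⊆
N(F). Conversely, let E₀ be the uncoded words with every second component equal to l₂⁰. By (b), μ_B
projects onto μ₁; Parseval in L²(μ₁), pulled back to L²(μ_B), gives P_x(C) ≥ |μ̂_B(0, x₂ - y₀)|²
(`le_tsum_generatedSet`). Along E₀ the difference x₂ - y₀ is contracted by S₂⁻¹ at each step, and
P_x(E₀) is an average of its values at later points (`pathMeasure_le_of_forall`). Therefore P_x(E₀)
≤ 1 - |μ̂_B(0, S₂^{-n}(x₂ - y₀))|² → 0. The Markov property then removes any finite prefix, so N(F)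
\ C is null. -/

namespace AffineIFS

/-! ### Fourier transforms of invariant measures and their infinite products -/

section Fourier

variable {ι : Type*} [Fintype ι]

lemma expFun_add_left (p q x : ι → ℝ) : expFun (p + q) x = expFun p x * expFun q x := by
  rw [expFun, expFun, expFun, ← Complex.exp_add, add_dotProduct]
  push_cast
  ring_nf

lemma expFun_comm (p x : ι → ℝ) : expFun p x = expFun x p := by
  rw [expFun, expFun, dotProduct_comm]

lemma expFun_zero (p : ι → ℝ) : expFun p 0 = 1 := by simp [expFun]

lemma continuous_expFun : Continuous fun z : (ι → ℝ) × (ι → ℝ) => expFun z.1 z.2 := by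
  unfold expFun
  have : Continuous fun z : (ι → ℝ) × (ι → ℝ) => z.1 ⬝ᵥ z.2 :=
    continuous_fst.dotProduct continuous_snd
  fun_prop

lemma continuous_expFun_left (x : ι → ℝ) : Continuous fun t => expFun t x :=
  continuous_expFun.comp (by fun_prop : Continuous fun t : ι → ℝ => (t, x))

lemma continuous_expFun_right (p : ι → ℝ) : Continuous (expFun p) :=
  continuous_expFun.comp (by fun_prop : Continuous fun t : ι → ℝ => (p, t))

lemma conj_expFun (p x : ι → ℝ) : (starRingEnd ℂ) (expFun p x) = expFun p (-x) := by
  rw [expFun, expFun, ← Complex.exp_conj]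
  simp [Complex.conj_ofNat]

lemma expFun_realVec_eq_one (b l : ι → ℤ) : expFun (realVec b) (realVec l) = 1 := by
  rw [expFun, Complex.exp_eq_one_iff]
  refine ⟨∑ i, b i * l i, ?_⟩
  simp only [dotProduct, realVec]
  push_cast
  ring

lemma W_nonneg (B : Finset (ι → ℤ)) (x : ι → ℝ) : 0 ≤ W B x := sq_nonneg _

lemma W_add_realVec (B : Finset (ι → ℤ)) (x : ι → ℝ) (l : ι → ℤ) :
    W B (x + realVec l) = W B x := by
  simp only [W, expFun_add, expFun_realVec_eq_one, mul_one]

lemma continuous_fourierTransform (μ : Measure (ι → ℝ)) [IsFiniteMeasure μ] :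
    Continuous (fourierTransform μ) := by
  refine continuous_of_dominated (bound := fun _ => 1)
    (fun x => (continuous_expFun_left x).aestronglyMeasurable)
    (fun x => Eventually.of_forall fun t => (norm_expFun t x).le) (integrable_const 1)
    (Eventually.of_forall fun t => continuous_expFun_right t)

lemma fourierTransform_zero (μ : Measure (ι → ℝ)) [IsProbabilityMeasure μ] :
    fourierTransform μ 0 = 1 := by
  simp [fourierTransform, expFun_zero]

/-- The function `m_B`, with `W_B = |m_B|²`. -/
noncomputable def mask (B : Finset (ι → ℤ)) (x : ι → ℝ) : ℂ :=
  (1 / (B.card : ℂ)) * ∑ b ∈ B, expFun (realVec b) x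

/-- Up to the factor 2π in the frequency this is the characteristic function, which determines a
finite measure. -/
lemma ext_of_fourierTransform {μ ν : Measure (ι → ℝ)} [IsFiniteMeasure μ] [IsFiniteMeasure ν]
    (h : fourierTransform μ = fourierTransform ν) : μ = ν := by
  refine Measure.ext_of_charFunDual (funext fun f => ?_)
  classical
  -- The frequency that represents the functional: 2π t·x = f(t).
  set x : ι → ℝ := fun i => (2 * Real.pi)⁻¹ * f (Pi.single i 1) with hx
  have key : ∀ t, expFun t x = Complex.exp (f t * Complex.I) := by
    intro t
    have h1 : f t = ∑ i, t i * f (Pi.single i 1) := by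
      conv_lhs => rw [pi_eq_sum_univ' t]
      simp
    have h2 : 2 * Real.pi * (t ⬝ᵥ x) = f t := by
      rw [h1, dotProduct, Finset.mul_sum]
      refine Finset.sum_congr rfl fun i _ => ?_
      rw [hx]
      field_simp
    rw [expFun, ← h2]
    push_cast
    ring_nf
  have := congrFun h x
  simpa only [fourierTransform, key, charFunDual_apply] using this

variable [DecidableEq ι]

lemma realMat_transpose {κ : Type*} (R : Matrix κ κ ℤ) : realMat Rᵀ = (realMat R)ᵀ := rfl

lemma IsExpanding.isUnit_det {R : Matrix ι ι ℤ} (hR : IsExpanding R) :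
    IsUnit (realMat R).det := by
  have h1 : R.map (fun a => (a : ℂ)) = (Complex.ofRealHom.mapMatrix (realMat R)) := by
    ext a b; simp [realMat]
  have h0 : IsUnit (R.map (fun a => (a : ℂ))) := by
    by_contra h
    have := hR 0 ((spectrum.zero_mem_iff ℂ).2 h)
    simp at this
    linarith
  rw [h1, Matrix.isUnit_iff_isUnit_det, ← RingHom.map_det, isUnit_iff_ne_zero] at h0
  rw [isUnit_iff_ne_zero]
  intro h
  rw [h] at h0
  simp at h0

lemma IsExpanding.isUnit_det_transpose {R : Matrix ι ι ℤ} (hR : IsExpanding R) :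
    IsUnit (realMat Rᵀ).det := by
  rw [realMat_transpose, Matrix.det_transpose]
  exact hR.isUnit_det

lemma IsExpanding.tendsto_inv_pow_mulVec {R : Matrix ι ι ℤ} (hR : IsExpanding R) (x : ι → ℝ) :
    Tendsto (fun n : ℕ => (realMat Rᵀ)⁻¹ ^ n *ᵥ x) atTop (𝓝 0) := by
  rw [tendsto_pi_nhds]
  intro i
  have h : ∀ j, Tendsto (fun n : ℕ => ((realMat R)⁻¹ ^ n) j i * x j) atTop (𝓝 (0 * x j)) :=
    fun j => ((tendsto_zero_iff_norm_tendsto_zero.2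
      (summable_entries R hR j i).tendsto_atTop_zero)).mul_const _
  have h2 := tendsto_finsetSum Finset.univ fun j _ => h j
  simp only [zero_mul, Finset.sum_const_zero] at h2
  refine h2.congr fun n => ?_
  rw [realMat_transpose, ← Matrix.transpose_nonsing_inv, ← Matrix.transpose_pow]
  rfl

lemma expFun_inv_mulVec (R : Matrix ι ι ℤ) (t x : ι → ℝ) :
    expFun ((realMat R)⁻¹ *ᵥ t) x = expFun t ((realMat Rᵀ)⁻¹ *ᵥ x) := by
  rw [expFun, expFun, realMat_transpose, ← Matrix.transpose_nonsing_inv, Matrix.mulVec_transpose,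
    dotProduct_comm, Matrix.dotProduct_mulVec, dotProduct_comm]

/-- The invariance identity tested on an exponential; R⁻¹ moves across the dot product as S⁻¹. -/
lemma IsInvariantMeasure.fourierTransform_eq {R : Matrix ι ι ℤ} {B : Finset (ι → ℤ)}
    {μ : Measure (ι → ℝ)} (h : IsInvariantMeasure R B μ) (x : ι → ℝ) :
    fourierTransform μ x =
      mask B ((realMat Rᵀ)⁻¹ *ᵥ x) * fourierTransform μ ((realMat Rᵀ)⁻¹ *ᵥ x) := by
  rw [fourierTransform, h.2 _ (continuous_expFun_left x), mask, mul_assoc, Finset.sum_mul]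
  congr 1
  refine Finset.sum_congr rfl fun b _ => ?_
  rw [fourierTransform, ← integral_const_mul]
  refine integral_congr_ae (Eventually.of_forall fun t => ?_)
  simp only [ifsMap]
  rw [expFun_inv_mulVec, expFun_add_left, mul_comm]

lemma IsInvariantMeasure.fourierTransform_eq_prod {R : Matrix ι ι ℤ} {B : Finset (ι → ℤ)}
    {μ : Measure (ι → ℝ)} (h : IsInvariantMeasure R B μ) (x : ι → ℝ) (n : ℕ) :
    fourierTransform μ x = (∏ k ∈ Finset.range n, mask B ((realMat Rᵀ)⁻¹ ^ (k + 1) *ᵥ x)) *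
      fourierTransform μ ((realMat Rᵀ)⁻¹ ^ n *ᵥ x) := by
  induction n with
  | zero => simp
  | succ n ih =>
    rw [ih, h.fourierTransform_eq, Finset.prod_range_succ, Matrix.mulVec_mulVec, ← pow_succ',
      mul_assoc]

/-- The partial product is μ̂(x) / μ̂(S^{-n}x) once the denominator is nonzero, and the denominator
tends to μ̂(0) = 1. Contraction is assumed only as convergence at x, so that the result also serves
the block A₁, whose contraction is inherited from S. -/
lemma IsInvariantMeasure.tendsto_prod_mask {R : Matrix ι ι ℤ} {B : Finset (ι → ℤ)}
    {μ : Measure (ι → ℝ)} (h : IsInvariantMeasure R B μ) (x : ι → ℝ)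
    (hx : Tendsto (fun n : ℕ => (realMat Rᵀ)⁻¹ ^ n *ᵥ x) atTop (𝓝 0)) :
    Tendsto (fun n => ∏ k ∈ Finset.range n, mask B ((realMat Rᵀ)⁻¹ ^ (k + 1) *ᵥ x)) atTop
      (𝓝 (fourierTransform μ x)) := by
  have := h.1
  have h1 : Tendsto (fun n : ℕ => fourierTransform μ ((realMat Rᵀ)⁻¹ ^ n *ᵥ x)) atTop (𝓝 1) := by
    have := ((continuous_fourierTransform μ).tendsto 0).comp hx
    rwa [fourierTransform_zero] at this
  have h2 := (tendsto_const_nhds (x := fourierTransform μ x)).div h1 one_ne_zero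
  rw [div_one] at h2
  refine h2.congr' ?_
  filter_upwards [h1.eventually_ne one_ne_zero] with n hn
  exact (div_eq_iff hn).2 (h.fourierTransform_eq_prod x n)

lemma IsInvariantMeasure.tendsto_prod_W {R : Matrix ι ι ℤ} {B : Finset (ι → ℤ)}
    {μ : Measure (ι → ℝ)} (h : IsInvariantMeasure R B μ) (x : ι → ℝ)
    (hx : Tendsto (fun n : ℕ => (realMat Rᵀ)⁻¹ ^ n *ᵥ x) atTop (𝓝 0)) :
    Tendsto (fun n => ∏ k ∈ Finset.range n, W B ((realMat Rᵀ)⁻¹ ^ (k + 1) *ᵥ x)) atTop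
      (𝓝 (‖fourierTransform μ x‖ ^ 2)) := by
  refine ((h.tendsto_prod_mask x hx).norm.pow 2).congr fun n => ?_
  rw [norm_prod, ← Finset.prod_pow]
  rfl

lemma IsInvariantMeasure.unique {R : Matrix ι ι ℤ} {B : Finset (ι → ℤ)}
    {μ ν : Measure (ι → ℝ)} (hμ : IsInvariantMeasure R B μ) (hν : IsInvariantMeasure R B ν)
    (hx : ∀ x, Tendsto (fun n : ℕ => (realMat Rᵀ)⁻¹ ^ n *ᵥ x) atTop (𝓝 0)) : μ = ν := by
  have := hμ.1
  have := hν.1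
  exact ext_of_fourierTransform (funext fun x =>
    tendsto_nhds_unique (hμ.tendsto_prod_mask x (hx x)) (hν.tendsto_prod_mask x (hx x)))

end Fourier

end AffineIFS

namespace AffineIFS

/-! ### Cylinders, uniqueness and Markov property of the path measures -/

section PathMeasure

variable {ι : Type*} [Fintype ι] [DecidableEq ι]

lemma sigmaPath_consWord (R : Matrix ι ι ℤ) {L : Finset (ι → ℤ)} (l : L) (ω : ℕ → L)
    (x : ι → ℝ) (n : ℕ) : sigmaPath R (consWord l ω) x (n + 1) =
      sigmaPath R ω (ifsMap Rᵀ (l : ι → ℤ) x) n := by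
  induction n with
  | zero => rfl
  | succ n ih => rw [sigmaPath, ih]; rfl

lemma sigmaPath_eq {R : Matrix ι ι ℤ} (hS : IsUnit (realMat Rᵀ).det) {L : Finset (ι → ℤ)}
    (ω : ℕ → L) (x : ι → ℝ) (n : ℕ) : sigmaPath R ω x n = (realMat Rᵀ)⁻¹ ^ n *ᵥ
      (x + ∑ k ∈ Finset.range n, realMat Rᵀ ^ k *ᵥ realVec (ω k : ι → ℤ)) := by
  induction n with
  | zero => simp [sigmaPath]
  | succ n ih =>
    rw [sigmaPath, ih, ifsMap, Finset.sum_range_succ, ← add_assoc, pow_succ',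
      ← Matrix.mulVec_mulVec]
    congr 1
    rw [Matrix.mulVec_add _ _ (_ *ᵥ _), Matrix.mulVec_mulVec, Matrix.inv_pow',
      Matrix.nonsing_inv_mul _ (by rw [Matrix.det_pow]; exact hS.pow n), Matrix.one_mulVec]

lemma consWord_head_tail {α : Type*} (ω : ℕ → α) : consWord (ω 0) (fun n => ω (n + 1)) = ω := by
  funext n
  cases n <;> rfl

lemma measurable_consWord_right {α : Type*} [MeasurableSpace α] (l : α) :
    Measurable (consWord l) :=
  measurable_consWord.comp (measurable_const.prodMk measurable_id)

/-- The cylinder of the words which agree with `ω` on the first `n` letters. -/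
def cyl {α : Type*} (ω : ℕ → α) (n : ℕ) : Set (ℕ → α) := {ω' | ∀ k < n, ω' k = ω k}

lemma cyl_succ {α : Type*} (ω : ℕ → α) (n : ℕ) (l : α) :
    consWord l ⁻¹' cyl ω (n + 1) =
      {_η | l = ω 0} ∩ cyl (fun k => ω (k + 1)) n := by
  ext η
  simp only [cyl, Set.mem_preimage, Set.mem_ofPred_eq, Set.mem_inter_iff]
  constructor
  · exact fun h => ⟨h 0 (by omega), fun k hk => h (k + 1) (by omega)⟩
  · rintro ⟨h0, h⟩ k hk
    cases k with
    | zero => exact h0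
    | succ k => exact h k (by omega)

lemma measurableSet_cyl {α : Type*} [MeasurableSpace α] [MeasurableSingletonClass α]
    (ω : ℕ → α) (n : ℕ) : MeasurableSet (cyl ω n) := by
  have : cyl ω n = ⋂ k ∈ Finset.range n, (fun η : ℕ → α => η k) ⁻¹' {ω k} := by
    ext η; simp [cyl]
  rw [this]
  exact Finset.measurableSet_biInter _ fun k _ => measurable_pi_apply k (measurableSet_singleton _)

/-- Two cylinders that meet are nested, and any common word names the smaller one. -/
lemma isPiSystem_cyl {α : Type*} :
    IsPiSystem {s : Set (ℕ → α) | ∃ ω n, s = cyl ω n} := by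
  rintro _ ⟨ω, n, rfl⟩ _ ⟨η, m, rfl⟩ ⟨ζ, h1, h2⟩
  refine ⟨ζ, max n m, ?_⟩
  ext ξ
  simp only [cyl, Set.mem_inter_iff, Set.mem_ofPred_eq, lt_max_iff] at h1 h2 ⊢
  constructor
  · rintro ⟨h3, h4⟩ k (hk | hk)
    · rw [h3 k hk, h1 k hk]
    · rw [h4 k hk, h2 k hk]
  · intro h
    exact ⟨fun k hk => by rw [h k (Or.inl hk), h1 k hk],
      fun k hk => by rw [h k (Or.inr hk), h2 k hk]⟩

lemma generateFrom_cyl {α : Type*} [MeasurableSpace α] [MeasurableSingletonClass α] [Finite α] :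
    (MeasurableSpace.pi : MeasurableSpace (ℕ → α)) =
      MeasurableSpace.generateFrom {s : Set (ℕ → α) | ∃ ω n, s = cyl ω n} := by
  refine le_antisymm ?_ (MeasurableSpace.generateFrom_le ?_)
  · refine iSup_le fun k => ?_
    rintro _ ⟨t, -, rfl⟩
    -- A condition on letter k is a finite union over prefixes of length k + 1. `Fin.ofNat` extends
    -- each prefix periodically to a word; the letters beyond the prefix do not matter.
    have h : (fun η : ℕ → α => η k) ⁻¹' t = ⋃ w : {w : Fin (k + 1) → α // w (Fin.last k) ∈ t},
        cyl (fun i => w.1 (Fin.ofNat (k + 1) i)) (k + 1) := by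
      ext η
      simp only [cyl, Set.mem_preimage, Set.mem_iUnion, Set.mem_ofPred_eq]
      constructor
      · intro hη
        refine ⟨⟨fun i => η i, hη⟩, fun j hj => ?_⟩
        simp [Nat.mod_eq_of_lt hj]
      · rintro ⟨w, hw⟩
        rw [hw k (by omega)]
        convert w.2
        ext
        simp
    rw [h]
    exact MeasurableSet.iUnion fun w => MeasurableSpace.measurableSet_generateFrom ⟨_, _, rfl⟩
  · rintro _ ⟨ω, n, rfl⟩
    exact measurableSet_cyl ω n

variable {R : Matrix ι ι ℤ} {B L : Finset (ι → ℤ)}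

lemma IsPathMeasure.unique {x : ι → ℝ} {P Q : Measure (ℕ → L)} (hP : IsPathMeasure R B L x P)
    (hQ : IsPathMeasure R B L x Q) : P = Q := by
  have := hP.1
  have := hQ.1
  refine ext_of_generate_finite _ generateFrom_cyl isPiSystem_cyl ?_ (by simp)
  rintro _ ⟨ω, n, rfl⟩
  exact (hP.2 ω n).trans (hQ.2 ω n).symm

/-- The Markov property of the path measures at the first step. -/
lemma pathMeasure_apply (hB : B.Nonempty) (h : IsHadamardTriple R B L) (x : ι → ℝ)
    {A : Set (ℕ → L)} (hA : MeasurableSet A) : pathMeasure R B L x A =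
      ∑ l : L, ENNReal.ofReal (W B (ifsMap Rᵀ (l : ι → ℤ) x)) *
        pathMeasure R B L (ifsMap Rᵀ (l : ι → ℤ) x) (consWord l ⁻¹' A) := by
  -- Draw the first letter with its weight and continue from the new point: this mixture has the
  -- cylinder values of P_x, so uniqueness identifies the two.
  set Q : Measure (ℕ → L) := ∑ l : L, ENNReal.ofReal (W B (ifsMap Rᵀ (l : ι → ℤ) x)) •
    (pathMeasure R B L (ifsMap Rᵀ (l : ι → ℤ) x)).map (consWord l) with hQ
  have hQA : ∀ A, MeasurableSet A → Q A =
      ∑ l : L, ENNReal.ofReal (W B (ifsMap Rᵀ (l : ι → ℤ) x)) *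
        pathMeasure R B L (ifsMap Rᵀ (l : ι → ℤ) x) (consWord l ⁻¹' A) := by
    intro A hA
    rw [hQ, Measure.finsetSum_apply]
    refine Finset.sum_congr rfl fun l _ => ?_
    rw [Measure.smul_apply, Measure.map_apply (measurable_consWord_right l) hA, smul_eq_mul]
  have hP := fun y => isPathMeasure_pathMeasure R B L hB h y
  have := fun y => (hP y).1
  have hQu : Q Set.univ = 1 := by
    rw [hQA _ MeasurableSet.univ]
    simp only [Set.preimage_univ, measure_univ, mul_one]
    rw [← ENNReal.ofReal_sum_of_nonneg (fun _ _ => W_nonneg _ _), sum_W_ifsMap R B L hB h,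
      ENNReal.ofReal_one]
  have hQP : IsPathMeasure R B L x Q := by
    refine ⟨⟨hQu⟩, fun ω n => ?_⟩
    cases n with
    | zero => simpa using hQu
    | succ n =>
      change Q (cyl ω (n + 1)) = _
      rw [hQA _ (measurableSet_cyl ω _), Finset.sum_eq_single (ω 0)]
      · have h1 : consWord (ω 0) ⁻¹' cyl ω (n + 1) = cyl (fun k => ω (k + 1)) n := by
          rw [cyl_succ]; simp
        rw [h1, Finset.prod_range_succ', mul_comm (Finset.prod _ _),
          ENNReal.ofReal_mul (W_nonneg _ _)]
        congr 1
        refine ((hP _).2 (fun k => ω (k + 1)) n).trans ?_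
        congr 1
        refine Finset.prod_congr rfl fun k _ => ?_
        rw [← sigmaPath_consWord, consWord_head_tail]
      · intro l _ hl
        have h1 : consWord l ⁻¹' cyl ω (n + 1) = ∅ := by
          rw [cyl_succ]; simp [hl]
        rw [h1, measure_empty, mul_zero]
      · simp
  rw [(hP x).unique hQP, hQA A hA]

lemma tendsto_prod_pathMeasure_singleton (hB : B.Nonempty) (h : IsHadamardTriple R B L)
    (x : ι → ℝ) (ω : ℕ → L) :
    Tendsto (fun n => ENNReal.ofReal (∏ k ∈ Finset.range n, W B (sigmaPath R ω x (k + 1)))) atTop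
      (𝓝 (pathMeasure R B L x {ω})) := by
  have hP := isPathMeasure_pathMeasure R B L hB h x
  have := hP.1
  have h1 : ({ω} : Set (ℕ → L)) = ⋂ n, cyl ω n := by
    ext η
    simp only [cyl, Set.mem_singleton_iff, Set.mem_iInter, Set.mem_ofPred_eq]
    exact ⟨fun hη _ k _ => by rw [hη], fun hη => funext fun k => hη (k + 1) k (by omega)⟩
  rw [h1]
  have h2 := tendsto_measure_iInter_atTop (μ := pathMeasure R B L x) (s := cyl ω)
    (fun n => (measurableSet_cyl ω n).nullMeasurableSet)
    (fun _ _ _ _ hη k _ => hη k (by omega)) ⟨0, measure_ne_top _ _⟩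
  exact h2.congr fun n => hP.2 ω n

end PathMeasure

end AffineIFS

namespace AffineIFS

/-! ### Words that code the points of the generated set -/

section Coding

variable {ι : Type*} [Fintype ι]

lemma realMat_mulVec_realVec (M : Matrix ι ι ℤ) (v : ι → ℤ) :
    realMat M *ᵥ realVec v = realVec (M *ᵥ v) := by
  funext i
  simp [Matrix.mulVec, dotProduct, realMat, realVec]

variable [DecidableEq ι]

lemma realMat_pow_mulVec_realVec (M : Matrix ι ι ℤ) (v : ι → ℤ) (n : ℕ) :
    realMat M ^ n *ᵥ realVec v = realVec (M ^ n *ᵥ v) := by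
  induction n with
  | zero => simp
  | succ n ih =>
    rw [pow_succ', ← Matrix.mulVec_mulVec, ih, realMat_mulVec_realVec, Matrix.mulVec_mulVec,
      ← pow_succ']

lemma inv_pow_mulVec_pow_add {M : Matrix ι ι ℝ} (hM : IsUnit M.det) (j i : ℕ) (v : ι → ℝ) :
    M⁻¹ ^ j *ᵥ (M ^ (j + i) *ᵥ v) = M ^ i *ᵥ v := by
  rw [Matrix.mulVec_mulVec, pow_add, ← mul_assoc, Matrix.inv_pow',
    Matrix.nonsing_inv_mul _ (by rw [Matrix.det_pow]; exact hM.pow j), one_mul]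

/-- The word `ω` codes the point `p` relative to `Γ`:
`p ∈ ω_1 + S ω_2 + ⋯ + S^{n-1} ω_n + Sⁿ Γ` for all large `n`. -/
def Codes (R : Matrix ι ι ℤ) {L : Finset (ι → ℤ)} (Γ : Set (ι → ℝ)) (ω : ℕ → L)
    (p : ι → ℝ) : Prop :=
  ∃ n₀ : ℕ, ∀ n ≥ n₀, ∃ q ∈ Γ,
    p = ∑ k ∈ Finset.range n, realMat Rᵀ ^ k *ᵥ realVec (ω k : ι → ℤ) + realMat Rᵀ ^ n *ᵥ q

variable {R : Matrix ι ι ℤ} {B L : Finset (ι → ℤ)} {Γ : Set (ι → ℝ)}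

lemma Codes.consWord {ω : ℕ → L} {p : ι → ℝ} (h : Codes R Γ ω p) (l : L) :
    Codes R Γ (consWord l ω) (realVec (l : ι → ℤ) + realMat Rᵀ *ᵥ p) := by
  obtain ⟨n₀, h⟩ := h
  refine ⟨n₀ + 1, fun n hn => ?_⟩
  obtain ⟨n, rfl⟩ : ∃ m, n = m + 1 := ⟨n - 1, by omega⟩
  obtain ⟨q, hq, rfl⟩ := h n (by omega)
  refine ⟨q, hq, ?_⟩
  rw [Finset.sum_range_succ', Matrix.mulVec_add, Matrix.mulVec_sum]
  simp only [AffineIFS.consWord, Matrix.mulVec_mulVec, ← pow_succ', pow_zero, Matrix.one_mulVec]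
  abel

/-- Iterating q = l + Sq' inside Γ produces the digits of a word, with an expansion valid at every
length. -/
lemma exists_codes_of_mem (hΓ : Γ ⊆ (fun v => realMat Rᵀ *ᵥ v) '' Γ +
    realVec '' (L : Set (ι → ℤ))) {p : ι → ℝ} (hp : p ∈ Γ) :
    ∃ ω : ℕ → L, Codes R Γ ω p := by
  have h : ∀ q : Γ, ∃ (q' : Γ) (l : L), (q : ι → ℝ) = realVec (l : ι → ℤ) + realMat Rᵀ *ᵥ q' := by
    intro q
    obtain ⟨_, ⟨q', hq', rfl⟩, _, ⟨l, hl, rfl⟩, h⟩ := hΓ q.2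
    exact ⟨⟨q', hq'⟩, ⟨l, hl⟩, by rw [← h, add_comm]⟩
  choose next letter hnext using h
  refine ⟨fun k => letter (next^[k] ⟨p, hp⟩), 0, fun n _ =>
    ⟨next^[n] ⟨p, hp⟩, Subtype.coe_prop _, ?_⟩⟩
  induction n with
  | zero => simp
  | succ n ih =>
    conv_lhs => rw [ih (Nat.zero_le _), hnext (next^[n] ⟨p, hp⟩)]
    rw [Finset.sum_range_succ, Function.iterate_succ_apply', Matrix.mulVec_add,
      Matrix.mulVec_mulVec, ← pow_succ, add_assoc]

lemma exists_codes (hΓ : Γ ⊆ (fun v => realMat Rᵀ *ᵥ v) '' Γ +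
    realVec '' (L : Set (ι → ℤ))) {p : ι → ℝ} (hp : p ∈ generatedSet R L Γ) :
    ∃ ω : ℕ → L, Codes R Γ ω p := by
  obtain ⟨n, l, hl, q, hq, rfl⟩ := Set.mem_iUnion.1 hp
  clear hp
  induction n with
  | zero => simpa using exists_codes_of_mem hΓ hq
  | succ n ih =>
    obtain ⟨ω, hω⟩ := ih (fun k => l k.succ) fun k => hl _
    refine ⟨consWord ⟨l 0, hl 0⟩ ω, ?_⟩
    convert hω.consWord ⟨l 0, hl 0⟩ using 1
    rw [Fin.sum_univ_succ, Matrix.mulVec_add, Matrix.mulVec_sum]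
    simp only [Matrix.mulVec_mulVec, ← pow_succ', pow_zero, Matrix.one_mulVec, Fin.val_zero,
      Fin.val_succ, add_assoc]

lemma Codes.mem_generatedSet {ω : ℕ → L} {p : ι → ℝ} (h : Codes R Γ ω p) :
    p ∈ generatedSet R L Γ := by
  obtain ⟨n, h⟩ := h
  obtain ⟨q, hq, hp⟩ := h n le_rfl
  refine Set.mem_iUnion.2 ⟨n, fun k => ω k, fun k => (ω k).2, q, hq, ?_⟩
  rw [hp, Finset.sum_range]

lemma subset_generatedSet : Γ ⊆ generatedSet R L Γ := fun p hp =>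
  Set.mem_iUnion.2 ⟨0, fun k => k.elim0, fun k => k.elim0, p, hp, by simp⟩

lemma countable_generatedSet (hΓ : Γ.Countable) : (generatedSet R L Γ).Countable := by
  refine Set.countable_iUnion fun n => ?_
  have : Countable Γ := hΓ.to_subtype
  refine (Set.countable_range fun z : (Fin n → L) × Γ => ∑ k : Fin n, (realMat Rᵀ ^ (k : ℕ)) *ᵥ
    realVec (z.1 k : ι → ℤ) + (realMat Rᵀ ^ n) *ᵥ (z.2 : ι → ℝ)).mono ?_
  rintro _ ⟨l, hl, p, hp, rfl⟩
  exact ⟨(fun k => ⟨l k, hl k⟩, ⟨p, hp⟩), rfl⟩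

/-- Compare the expansions of lengths n and n + 1 and cancel Sⁿ. -/
lemma Codes.eventually_eq (hS : IsUnit (realMat Rᵀ).det) {ω : ℕ → L} {p : ι → ℝ}
    (h : Codes R Γ ω p) :
    ∀ᶠ n in atTop, ∃ q ∈ Γ, ∃ q' ∈ Γ, q = realVec (ω n : ι → ℤ) + realMat Rᵀ *ᵥ q' := by
  obtain ⟨n₀, h⟩ := h
  filter_upwards [eventually_ge_atTop n₀] with n hn
  obtain ⟨q, hq, h1⟩ := h n hn
  obtain ⟨q', hq', h2⟩ := h (n + 1) (by omega)
  refine ⟨q, hq, q', hq', ?_⟩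
  rw [h1, Finset.sum_range_succ, add_assoc, add_right_inj] at h2
  have h3 := congrArg (fun v => (realMat Rᵀ)⁻¹ ^ n *ᵥ v) h2
  have h4 : ∀ v, (realMat Rᵀ)⁻¹ ^ n *ᵥ (realMat Rᵀ ^ n *ᵥ v) = v := fun v => by
    simpa using inv_pow_mulVec_pow_add hS n 0 v
  simp only [Matrix.mulVec_add, inv_pow_mulVec_pow_add hS n 1, h4, pow_one] at h3
  exact h3

lemma W_sigmaPath (hS : IsUnit (realMat Rᵀ).det) (ω : ℕ → L) {x p q : ι → ℝ}
    (hq : IsSPeriod R (W B) q) {n : ℕ}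
    (hp : p = ∑ k ∈ Finset.range n, realMat Rᵀ ^ k *ᵥ realVec (ω k : ι → ℤ) + realMat Rᵀ ^ n *ᵥ q)
    {j : ℕ} (hj : j ≤ n) :
    W B (sigmaPath R ω x j) = W B ((realMat Rᵀ)⁻¹ ^ j *ᵥ (x + p)) := by
  obtain ⟨m, rfl⟩ := Nat.exists_eq_add_of_le hj
  -- Applying S^{-j} turns the first j digits into the path, the other m = n - j digits into an
  -- integer vector, and the remainder into S^m q. The last two are periods of `W B`.
  have h1 : (realMat Rᵀ)⁻¹ ^ j *ᵥ (x + p) = sigmaPath R ω x j +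
      realVec (∑ i ∈ Finset.range m, Rᵀ ^ i *ᵥ (ω (j + i) : ι → ℤ)) + realMat Rᵀ ^ m *ᵥ q := by
    have h2 : realVec (∑ i ∈ Finset.range m, Rᵀ ^ i *ᵥ (ω (j + i) : ι → ℤ)) =
        ∑ i ∈ Finset.range m, realMat Rᵀ ^ i *ᵥ realVec (ω (j + i) : ι → ℤ) := by
      simp only [realMat_pow_mulVec_realVec]
      funext a
      simp [realVec]
    rw [hp, Finset.sum_range_add, sigmaPath_eq hS, h2, ← add_assoc, ← add_assoc,
      Matrix.mulVec_add, Matrix.mulVec_add, Matrix.mulVec_sum _ (Finset.range m)]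
    simp only [inv_pow_mulVec_pow_add hS]
  rw [h1, hq, W_add_realVec]

/-- Both sides are limits of the same products: cylinders shrink to ω on the left, and |μ̂_B|² is
the infinite product of W_B on the right. -/
lemma Codes.pathMeasure_singleton (hR : IsExpanding R) (hB : B.Nonempty)
    (hRBL : IsHadamardTriple R B L) (hΓ : ∀ q ∈ Γ, IsSPeriod R (W B) q)
    {ω : ℕ → L} {p : ι → ℝ} (h : Codes R Γ ω p) (x : ι → ℝ) :
    pathMeasure R B L x {ω} = ‖fourierTransform (invariantMeasure R B) (x + p)‖ₑ ^ 2 := by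
  have h1 := (ENNReal.continuous_ofReal.tendsto _).comp
    ((isInvariantMeasure_invariantMeasure R hR B hB).tendsto_prod_W (x + p)
      (hR.tendsto_inv_pow_mulVec _))
  rw [ENNReal.ofReal_pow (norm_nonneg _), ofReal_norm] at h1
  refine tendsto_nhds_unique ((tendsto_prod_pathMeasure_singleton hB hRBL x ω).congr' ?_) h1
  obtain ⟨n₀, h⟩ := h
  filter_upwards [eventually_ge_atTop n₀] with n hn
  obtain ⟨q, hq, hp⟩ := h n hn
  simp only [Function.comp]
  congr 1
  refine Finset.prod_congr rfl fun k hk => ?_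
  exact W_sigmaPath hR.isUnit_det_transpose ω (hΓ q hq) hp (Finset.mem_range.1 hk)

lemma Codes.word_unique (hR : IsExpanding R) (hB : B.Nonempty)
    (hRBL : IsHadamardTriple R B L) (hΓ : ∀ q ∈ Γ, IsSPeriod R (W B) q)
    {ω η : ℕ → L} {p : ι → ℝ} (hω : Codes R Γ ω p) (hη : Codes R Γ η p) : ω = η := by
  have := (isPathMeasure_pathMeasure R B L hB hRBL (-p)).1
  have := (isInvariantMeasure_invariantMeasure R hR B hB).1
  -- At the starting point -p each coding word is an atom of full mass, so there cannot be two.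
  have h1 := hω.pathMeasure_singleton hR hB hRBL hΓ (-p)
  have h2 := hη.pathMeasure_singleton hR hB hRBL hΓ (-p)
  rw [neg_add_cancel, fourierTransform_zero, enorm_one, one_pow] at h1 h2
  by_contra hne
  have h3 : pathMeasure R B L (-p) ({ω} ∪ {η}) = 1 + 1 := by
    rw [measure_union (by simpa using hne) (measurableSet_singleton _), h1, h2]
  have h4 : pathMeasure R B L (-p) ({ω} ∪ {η}) ≤ 1 := prob_le_one
  rw [h3] at h4
  norm_num at h4

lemma Codes.point_unique (hR : IsExpanding R) (hB : B.Nonempty)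
    (hΓ : ∀ q ∈ Γ, ∀ q' ∈ Γ, q ≠ q' →
      fourierTransform (invariantMeasure R B) (q - q') = 0)
    {ω : ℕ → L} {p p' : ι → ℝ} (h : Codes R Γ ω p) (h' : Codes R Γ ω p') : p = p' := by
  have := (isInvariantMeasure_invariantMeasure R hR B hB).1
  by_contra hne
  obtain ⟨n₀, h⟩ := h
  obtain ⟨n₀', h'⟩ := h'
  have h1 := ((continuous_fourierTransform (invariantMeasure R B)).tendsto 0).comp
    (hR.tendsto_inv_pow_mulVec (p - p'))
  rw [fourierTransform_zero] at h1
  refine zero_ne_one (tendsto_nhds_unique (tendsto_const_nhds.congr' ?_) h1)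
  filter_upwards [eventually_ge_atTop n₀, eventually_ge_atTop n₀'] with n hn hn'
  obtain ⟨q, hq, hp⟩ := h n hn
  obtain ⟨q', hq', hp'⟩ := h' n hn'
  have h2 : p - p' = realMat Rᵀ ^ n *ᵥ (q - q') := by
    rw [hp, hp', Matrix.mulVec_sub]
    abel
  have h3 : (realMat Rᵀ)⁻¹ ^ n *ᵥ (p - p') = q - q' := by
    have := inv_pow_mulVec_pow_add hR.isUnit_det_transpose n 0 (q - q')
    rwa [add_zero, pow_zero, Matrix.one_mulVec, ← h2] at this
  simp only [Function.comp, h3]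
  refine (hΓ q hq q' hq' fun h4 => hne ?_).symm
  rw [hp, hp', h4]

/-- Gives measurability of the set of coded words: choosing a coded point embeds it in the countable
generated set. -/
lemma countable_setOf_codes (hR : IsExpanding R) (hB : B.Nonempty)
    (hRBL : IsHadamardTriple R B L) (hΓ : ∀ q ∈ Γ, IsSPeriod R (W B) q) (hΓc : Γ.Countable) :
    {ω : ℕ → L | ∃ p, Codes R Γ ω p}.Countable := by
  have : Countable (generatedSet R L Γ) := (countable_generatedSet hΓc).to_subtype
  have hsurj : ∀ ω : {ω : ℕ → L | ∃ p, Codes R Γ ω p}, ∃ p, Codes R Γ ω.1 p := fun ω => ω.2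
  choose f hf using hsurj
  have hinj : Function.Injective fun ω => (⟨f ω, (hf ω).mem_generatedSet⟩ : generatedSet R L Γ) := by
    intro ω η h
    have h1 : f ω = f η := congrArg Subtype.val h
    exact Subtype.ext ((hf ω).word_unique hR hB hRBL hΓ (h1 ▸ hf η))
  exact hinj.countable

/-- The set of coded words has measure `∑_{p} |μ̂_B(x + p)|²`. -/
lemma pathMeasure_setOf_codes (hR : IsExpanding R) (hB : B.Nonempty)
    (hRBL : IsHadamardTriple R B L) (hper : ∀ q ∈ Γ, IsSPeriod R (W B) q)
    (horth : ∀ q ∈ Γ, ∀ q' ∈ Γ, q ≠ q' → fourierTransform (invariantMeasure R B) (q - q') = 0)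
    (hΓ : Γ ⊆ (fun v => realMat Rᵀ *ᵥ v) '' Γ + realVec '' (L : Set (ι → ℤ)))
    (hΓc : Γ.Countable) (x : ι → ℝ) :
    pathMeasure R B L x {ω | ∃ p, Codes R Γ ω p} = ∑' p : generatedSet R L Γ,
      ‖fourierTransform (invariantMeasure R B) (x + (p : ι → ℝ))‖ₑ ^ 2 := by
  have : Countable (generatedSet R L Γ) := (countable_generatedSet hΓc).to_subtype
  choose f hf using fun p : generatedSet R L Γ => exists_codes hΓ p.2
  have h1 : {ω : ℕ → L | ∃ p, Codes R Γ ω p} = ⋃ p, {f p} := by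
    ext ω
    simp only [Set.mem_ofPred_eq, Set.mem_iUnion, Set.mem_singleton_iff]
    constructor
    · rintro ⟨p, hp⟩
      exact ⟨⟨p, hp.mem_generatedSet⟩, hp.word_unique hR hB hRBL hper (hf _)⟩
    · rintro ⟨p, rfl⟩
      exact ⟨p, hf p⟩
  rw [h1, measure_iUnion _ fun _ => measurableSet_singleton _]
  · exact tsum_congr fun p => (hf p).pathMeasure_singleton hR hB hRBL hper x
  · intro p p' hne
    rw [Function.onFun, Set.disjoint_singleton]
    intro h
    exact hne (Subtype.ext ((hf p).point_unique hR hB horth (h ▸ hf p')))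

end Coding

end AffineIFS

namespace AffineIFS

/-! ### Orthogonality and countability of spectra -/

section Spectrum

variable {ι : Type*} [Fintype ι]

lemma inner_eq_fourierTransform {μ : Measure (ι → ℝ)} {F G : Lp ℂ 2 μ} {p q : ι → ℝ}
    (hF : (F : (ι → ℝ) → ℂ) =ᵐ[μ] expFun p) (hG : (G : (ι → ℝ) → ℂ) =ᵐ[μ] expFun q) :
    inner ℂ F G = fourierTransform μ (q - p) := by
  rw [L2.inner_def, fourierTransform]
  refine integral_congr_ae ?_
  filter_upwards [hF, hG] with t h1 h2
  rw [h1, h2, RCLike.inner_apply, conj_expFun, expFun_comm q, expFun_comm p, sub_eq_add_neg,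
    expFun_add, expFun_comm t q, expFun_comm t (-p)]
  simp [expFun, dotProduct_comm t p]

lemma norm_fourierTransform_neg (μ : Measure (ι → ℝ)) (x : ι → ℝ) :
    ‖fourierTransform μ (-x)‖ = ‖fourierTransform μ x‖ := by
  rw [fourierTransform, ← RCLike.norm_conj (fourierTransform μ x), fourierTransform,
    ← integral_conj]
  simp only [conj_expFun]

lemma memLp_expFun (μ : Measure (ι → ℝ)) [IsFiniteMeasure μ] (p : ι → ℝ) :
    MemLp (expFun p) 2 μ :=
  MemLp.of_bound (continuous_expFun_right p).aestronglyMeasurable 1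
    (Eventually.of_forall fun t => (norm_expFun p t).le)

lemma IsSpectrum.fourierTransform_sub_eq_zero {μ : Measure (ι → ℝ)} {Λ : Set (ι → ℝ)}
    (h : IsSpectrum μ Λ) {p q : ι → ℝ} (hp : p ∈ Λ) (hq : q ∈ Λ) (hpq : p ≠ q) :
    fourierTransform μ (p - q) = 0 := by
  obtain ⟨e, he⟩ := h
  rw [← inner_eq_fourierTransform (he ⟨q, hq⟩) (he ⟨p, hp⟩)]
  exact e.orthonormal.2 fun h => hpq (congrArg Subtype.val h).symm

/-- Orthonormal vectors lie at distance √2, so balls of radius 1/2 around them are disjoint in the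
separable space L²(μ). -/
lemma IsSpectrum.countable {μ : Measure (ι → ℝ)} [IsFiniteMeasure μ] {Λ : Set (ι → ℝ)}
    (h : IsSpectrum μ Λ) : Λ.Countable := by
  obtain ⟨e, -⟩ := h
  have : Fact ((2 : ℝ≥0∞) ≠ ∞) := ⟨by norm_num⟩
  have hsep : TopologicalSpace.SeparableSpace (Lp ℂ 2 μ) := inferInstance
  have h1 : Pairwise (Function.onFun Disjoint fun i : Λ => Metric.ball (e i) (1 / 2)) := by
    intro i j hij
    refine Metric.ball_disjoint_ball ?_
    rw [dist_eq_norm]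
    have h2 : ‖e i - e j‖ * ‖e i - e j‖ = 2 := by
      rw [@norm_sub_mul_self ℂ, e.orthonormal.2 hij, e.orthonormal.1, e.orthonormal.1]
      norm_num
    nlinarith [norm_nonneg (e i - e j)]
  exact (h1.countable_of_isOpen_disjoint (fun _ => Metric.isOpen_ball)
    fun i => Metric.nonempty_ball.2 (by norm_num))

end Spectrum

/-! ### Parseval's identity for functions of the first variable -/

section Projection

variable {r s : ℕ} {μ : Measure (Fin r ⊕ Fin s → ℝ)} {μ₁ : Measure (Fin r → ℝ)}

lemma expFun_comp_inl (p : Fin r → ℝ) (t : Fin r ⊕ Fin s → ℝ) :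
    expFun p (t ∘ Sum.inl) = expFun (Sum.elim p 0) t := by
  simp [expFun, dotProduct, Fintype.sum_sum_type]

lemma fourierTransform_of_measurePreserving
    (hμ : MeasurePreserving (fun t : Fin r ⊕ Fin s → ℝ => t ∘ Sum.inl) μ μ₁) (x : Fin r → ℝ) :
    fourierTransform μ₁ x = fourierTransform μ (Sum.elim x 0) := by
  rw [fourierTransform, ← hμ.map_eq, integral_map hμ.measurable.aemeasurable
    (continuous_expFun_left x).aestronglyMeasurable, fourierTransform]
  refine integral_congr_ae (Eventually.of_forall fun t => ?_)
  simp only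
  rw [expFun_comm, expFun_comp_inl, expFun_comm]

/-- Parseval's identity for the projection of an exponential function onto the functions of the
first variable. -/
lemma IsSpectrum.le_tsum_fourierTransform [IsProbabilityMeasure μ] [IsProbabilityMeasure μ₁]
    (hμ : MeasurePreserving (fun t : Fin r ⊕ Fin s → ℝ => t ∘ Sum.inl) μ μ₁)
    {Λ : Set (Fin r → ℝ)} (h : IsSpectrum μ₁ Λ) (x : Fin r → ℝ) (y : Fin s → ℝ) :
    ‖fourierTransform μ (Sum.elim 0 y)‖ₑ ^ 2 ≤
      ∑' p : Λ, ‖fourierTransform μ (Sum.elim (x + p) y)‖ₑ ^ 2 := by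
  obtain ⟨e, he⟩ := h
  -- V is the isometry F ↦ F ∘ pr₁, sending e_p to e_{(p,0)}.
  let V : Lp ℂ 2 μ₁ →L[ℂ] Lp ℂ 2 μ := (Lp.compMeasurePreservingₗᵢ ℂ _ hμ).toContinuousLinearMap
  have hV : ∀ (F : Lp ℂ 2 μ₁) (p : Fin r → ℝ), (F : (Fin r → ℝ) → ℂ) =ᵐ[μ₁] expFun p →
      (V F : (Fin r ⊕ Fin s → ℝ) → ℂ) =ᵐ[μ] expFun (Sum.elim p 0) := by
    intro F p hF
    refine (Lp.coeFn_compMeasurePreserving F hμ).trans ?_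
    refine (hμ.quasiMeasurePreserving.ae_eq_comp hF).trans ?_
    exact Eventually.of_forall fun t => expFun_comp_inl p t
  let f : Lp ℂ 2 μ := (memLp_expFun μ (-Sum.elim x y)).toLp
  let u : Lp ℂ 2 μ₁ := (memLp_expFun μ₁ (-x)).toLp
  have hf : (f : (Fin r ⊕ Fin s → ℝ) → ℂ) =ᵐ[μ] expFun (-Sum.elim x y) := MemLp.coeFn_toLp _
  have hu : (u : (Fin r → ℝ) → ℂ) =ᵐ[μ₁] expFun (-x) := MemLp.coeFn_toLp _
  have hun : ‖u‖ = 1 := by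
    have h1 : inner ℂ u u = 1 := by
      rw [inner_eq_fourierTransform hu hu, sub_self, fourierTransform_zero]
    rw [inner_self_eq_norm_sq_to_K] at h1
    have h2 : ((‖u‖ ^ 2 : ℝ) : ℂ) = 1 := by
      rw [Complex.ofReal_pow]
      exact h1
    rw [Complex.ofReal_eq_one] at h2
    nlinarith [norm_nonneg u]
  -- The coefficients of g = V*f in the basis e_p have modulus |μ̂(x + p, y)|, so their squares sum
  -- to ‖g‖². Testing g against the unit vector u = e_{-x} gives ‖g‖ ≥ |μ̂(0, y)|.
  set g := ContinuousLinearMap.adjoint V f with hg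
  have hge : ∀ p : Λ, ‖inner ℂ (e p) g‖ = ‖fourierTransform μ (Sum.elim (x + p) y)‖ := by
    intro p
    rw [hg, ContinuousLinearMap.adjoint_inner_right,
      inner_eq_fourierTransform (hV _ _ (he p)) hf, ← norm_fourierTransform_neg]
    congr 2
    ext i
    cases i <;> simp [add_comm]
  have hgu : ‖fourierTransform μ (Sum.elim 0 y)‖ ≤ ‖g‖ := by
    have h1 := norm_inner_le_norm (𝕜 := ℂ) u g
    rw [hun, one_mul, hg, ContinuousLinearMap.adjoint_inner_right,
      inner_eq_fourierTransform (hV _ _ hu) hf, ← norm_fourierTransform_neg] at h1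
    convert h1 using 3
    ext i
    cases i <;> simp
  have hsum : HasSum (fun p : Λ => ‖fourierTransform μ (Sum.elim (x + p) y)‖ ^ 2) (‖g‖ ^ 2) := by
    have h1 := e.hasSum_inner_mul_inner g g
    rw [inner_self_eq_norm_sq_to_K] at h1
    have h2 : ∀ p : Λ, inner ℂ g (e p) * inner ℂ (e p) g =
        ((‖fourierTransform μ (Sum.elim (x + p) y)‖ ^ 2 : ℝ) : ℂ) := by
      intro p
      rw [← inner_conj_symm, RCLike.conj_mul, hge]
      push_cast
      rfl
    simp only [h2] at h1
    refine Complex.hasSum_ofReal.1 ?_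
    rw [Complex.ofReal_pow]
    exact h1
  calc ‖fourierTransform μ (Sum.elim 0 y)‖ₑ ^ 2
      = ENNReal.ofReal (‖fourierTransform μ (Sum.elim 0 y)‖ ^ 2) := by
        rw [ENNReal.ofReal_pow (norm_nonneg _), ofReal_norm]
    _ ≤ ENNReal.ofReal (‖g‖ ^ 2) := ENNReal.ofReal_le_ofReal (by gcongr)
    _ = ∑' p : Λ, ‖fourierTransform μ (Sum.elim (x + p) y)‖ₑ ^ 2 := by
        rw [← hsum.tsum_eq, ENNReal.ofReal_tsum_of_nonneg (fun _ => sq_nonneg _) hsum.summable]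
        refine tsum_congr fun p => ?_
        rw [ENNReal.ofReal_pow (norm_nonneg _), ofReal_norm]

end Projection

end AffineIFS

namespace AffineIFS

/-! ### Words that stay in an invariant set -/

section Words

variable {ι : Type*} [Fintype ι] [DecidableEq ι] {R : Matrix ι ι ℤ} {B L : Finset (ι → ℤ)}

lemma exists_W_ifsMap_ne_zero (hB : B.Nonempty) (h : IsHadamardTriple R B L) (x : ι → ℝ) :
    ∃ l : L, W B (ifsMap Rᵀ (l : ι → ℤ) x) ≠ 0 := by
  by_contra! h0
  have := sum_W_ifsMap R B L hB h x
  simp [h0] at this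

/-- Trajectories are infinite, so even a single step inside an invariant set needs this: the weights
at each point sum to 1, hence some admissible letter is always available. -/
lemma exists_word_W_ne_zero (hB : B.Nonempty) (h : IsHadamardTriple R B L) (x : ι → ℝ) :
    ∃ ω : ℕ → L, ∀ n, 1 ≤ n → W B (sigmaPath R ω x n) ≠ 0 := by
  choose next hnext using exists_W_ifsMap_ne_zero hB h
  let f : (ι → ℝ) → ι → ℝ := fun z => ifsMap Rᵀ (next z : ι → ℤ) z
  have h1 : ∀ n, sigmaPath R (fun k => next (f^[k] x)) x n = f^[n] x := by
    intro n
    induction n with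
    | zero => rfl
    | succ n ih => rw [sigmaPath, ih, Function.iterate_succ_apply']
  refine ⟨fun k => next (f^[k] x), fun n hn => ?_⟩
  obtain ⟨n, rfl⟩ : ∃ m, n = m + 1 := ⟨n - 1, by omega⟩
  rw [h1, Function.iterate_succ_apply']
  exact hnext _

lemma IsInvariantSet.exists_ifsMap_mem (hB : B.Nonempty) (h : IsHadamardTriple R B L)
    {F : Set (ι → ℝ)} (hF : IsInvariantSet R B L F) {x : ι → ℝ} (hx : x ∈ F) :
    ∃ l ∈ L, ifsMap Rᵀ l x ∈ F := by
  obtain ⟨ω, hω⟩ := exists_word_W_ne_zero hB h x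
  exact ⟨ω 0, (ω 0).2, hF.2 x hx (subset_closure ⟨ω, hω, 1, le_rfl, rfl⟩)⟩

end Words

/-! ### Block triangular form of S -/

section BlockTriangular

variable {r s : ℕ} {R : Matrix (Fin r ⊕ Fin s) (Fin r ⊕ Fin s) ℤ}
  {B L : Finset (Fin r ⊕ Fin s → ℤ)}

lemma mem_timesPoint_univ {y : Fin s → ℝ} {v : Fin r ⊕ Fin s → ℝ} :
    v ∈ timesPoint Set.univ y ↔ v ∘ Sum.inr = y := by
  constructor
  · rintro ⟨x, -, rfl⟩
    rfl
  · rintro rfl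
    exact ⟨v ∘ Sum.inl, trivial, Sum.elim_comp_inl_inr v⟩

lemma mulVec_comp_inr (M : Matrix (Fin r ⊕ Fin s) (Fin r ⊕ Fin s) ℝ) (v : Fin r ⊕ Fin s → ℝ) :
    (M *ᵥ v) ∘ Sum.inr = M.toBlocks₂₁ *ᵥ (v ∘ Sum.inl) + M.toBlocks₂₂ *ᵥ (v ∘ Sum.inr) := by
  conv_lhs => rw [← Matrix.fromBlocks_toBlocks M, Matrix.fromBlocks_mulVec]
  rfl

lemma mulVec_comp_inl (M : Matrix (Fin r ⊕ Fin s) (Fin r ⊕ Fin s) ℝ) (v : Fin r ⊕ Fin s → ℝ) :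
    (M *ᵥ v) ∘ Sum.inl = M.toBlocks₁₁ *ᵥ (v ∘ Sum.inl) + M.toBlocks₁₂ *ᵥ (v ∘ Sum.inr) := by
  conv_lhs => rw [← Matrix.fromBlocks_toBlocks M, Matrix.fromBlocks_mulVec]
  rfl

/-- Pigeonhole: among the points (kv, y), k ∈ ℕ, two return to the invariant set through the same
letter, since L is finite. Subtracting the second coordinates of their images leaves (k - k') times
the block applied to v, which must vanish. -/
lemma toBlocks₂₁_inv_eq_zero (hB : B.Nonempty) (hRBL : IsHadamardTriple R B L) {y : Fin s → ℝ}
    (hinv : IsInvariantSet R B L (timesPoint Set.univ y)) :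
    (realMat Rᵀ)⁻¹.toBlocks₂₁ = 0 := by
  refine Matrix.ext_of_mulVec_single fun j => ?_
  set v : Fin r → ℝ := Pi.single j 1
  have h1 : ∀ k : ℕ, ∃ l : L, ifsMap Rᵀ (l : Fin r ⊕ Fin s → ℤ) (Sum.elim ((k : ℝ) • v) y) ∈
      timesPoint Set.univ y := by
    intro k
    obtain ⟨l, hl, h⟩ := hinv.exists_ifsMap_mem hB hRBL (x := Sum.elim ((k : ℝ) • v) y)
      ⟨_, trivial, rfl⟩
    exact ⟨⟨l, hl⟩, h⟩
  choose f hf using h1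
  obtain ⟨k, k', hne, hk⟩ := Finite.exists_ne_map_eq_of_infinite f
  have h2 := mem_timesPoint_univ.1 (hf k)
  have h3 := mem_timesPoint_univ.1 (hf k')
  rw [← hk] at h3
  replace h3 := h3.trans h2.symm
  rw [ifsMap, ifsMap, mulVec_comp_inr, mulVec_comp_inr] at h3
  have h4 : ∀ a : ℝ, (Sum.elim (a • v) y + realVec (f k : Fin r ⊕ Fin s → ℤ)) ∘ Sum.inl =
      a • v + realVec (f k : Fin r ⊕ Fin s → ℤ) ∘ Sum.inl := fun a => rfl
  have h5 : ∀ a : ℝ, (Sum.elim (a • v) y + realVec (f k : Fin r ⊕ Fin s → ℤ)) ∘ Sum.inr =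
      y + realVec (f k : Fin r ⊕ Fin s → ℤ) ∘ Sum.inr := fun a => rfl
  rw [h4, h4, h5, h5, add_left_inj, Matrix.mulVec_add, Matrix.mulVec_add, add_left_inj,
    Matrix.mulVec_smul, Matrix.mulVec_smul, ← sub_eq_zero, ← sub_smul, smul_eq_zero, sub_eq_zero,
    Nat.cast_inj] at h3
  rw [Matrix.zero_mulVec]
  exact h3.resolve_left hne.symm

/-- The inverse of an invertible block triangular matrix is block triangular of the same shape. -/
lemma toBlocks₂₁_eq_zero (hR : IsExpanding R) (h : (realMat Rᵀ)⁻¹.toBlocks₂₁ = 0) :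
    Rᵀ.toBlocks₂₁ = 0 := by
  have hS := hR.isUnit_det_transpose
  set T := (realMat Rᵀ)⁻¹ with hT
  have h1 : T = Matrix.fromBlocks T.toBlocks₁₁ T.toBlocks₁₂ 0 T.toBlocks₂₂ := by
    rw [← h, Matrix.fromBlocks_toBlocks]
  have h2 : IsUnit T := (Matrix.isUnit_iff_isUnit_det T).2 (by
    rw [hT]; exact Matrix.isUnit_nonsing_inv_det _ hS)
  have h3 : T⁻¹ = realMat Rᵀ := Matrix.nonsing_inv_nonsing_inv _ hS
  rw [h1, Matrix.isUnit_fromBlocks_zero₂₁] at h2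
  rw [h1, Matrix.inv_fromBlocks_zero₂₁_of_isUnit_iff _ _ _ (by simp [h2.1, h2.2])] at h3
  have h4 : (realMat Rᵀ).toBlocks₂₁ = 0 := by
    rw [← h3, Matrix.toBlocks_fromBlocks₂₁]
  ext i j
  have h5 := congrFun (congrFun h4 i) j
  simpa [realMat, Matrix.toBlocks₂₁] using h5

lemma realMat_transpose_eq (h : Rᵀ.toBlocks₂₁ = 0) :
    realMat Rᵀ = Matrix.fromBlocks (realMat R.toBlocks₁₁ᵀ) (realMat Rᵀ).toBlocks₁₂ 0
      (realMat Rᵀ.toBlocks₂₂) := by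
  have h1 : (realMat Rᵀ).toBlocks₂₁ = 0 := by
    ext i j
    have := congrFun (congrFun h i) j
    simpa [realMat, Matrix.toBlocks₂₁] using this
  refine (Matrix.fromBlocks_toBlocks _).symm.trans ?_
  rw [h1]
  rfl

lemma isUnit_blocks (hR : IsExpanding R) (h : Rᵀ.toBlocks₂₁ = 0) :
    IsUnit (realMat R.toBlocks₁₁ᵀ) ∧ IsUnit (realMat Rᵀ.toBlocks₂₂) := by
  rw [← Matrix.isUnit_fromBlocks_zero₂₁ (B := (realMat Rᵀ).toBlocks₁₂), ← realMat_transpose_eq h,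
    Matrix.isUnit_iff_isUnit_det]
  exact hR.isUnit_det_transpose

lemma exists_realMat_transpose_inv_eq (hR : IsExpanding R) (h : Rᵀ.toBlocks₂₁ = 0) :
    ∃ C, (realMat Rᵀ)⁻¹ = Matrix.fromBlocks (realMat R.toBlocks₁₁ᵀ)⁻¹ C 0
      (realMat Rᵀ.toBlocks₂₂)⁻¹ := by
  have h1 := isUnit_blocks hR h
  rw [realMat_transpose_eq h,
    Matrix.inv_fromBlocks_zero₂₁_of_isUnit_iff _ _ _ (by simp [h1.1, h1.2])]
  exact ⟨_, rfl⟩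

lemma transpose_mulVec_comp_inr (h : Rᵀ.toBlocks₂₁ = 0) (v : Fin r ⊕ Fin s → ℝ) :
    (realMat Rᵀ *ᵥ v) ∘ Sum.inr = realMat Rᵀ.toBlocks₂₂ *ᵥ (v ∘ Sum.inr) := by
  rw [mulVec_comp_inr, realMat_transpose_eq h]
  simp

lemma inv_mulVec_comp_inr (hR : IsExpanding R) (h : Rᵀ.toBlocks₂₁ = 0) (v : Fin r ⊕ Fin s → ℝ) :
    ((realMat Rᵀ)⁻¹ *ᵥ v) ∘ Sum.inr = (realMat Rᵀ.toBlocks₂₂)⁻¹ *ᵥ (v ∘ Sum.inr) := by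
  obtain ⟨C, hC⟩ := exists_realMat_transpose_inv_eq hR h
  rw [mulVec_comp_inr, hC]
  simp

lemma inv_mulVec_elim_zero (hR : IsExpanding R) (h : Rᵀ.toBlocks₂₁ = 0) (x : Fin r → ℝ) :
    (realMat Rᵀ)⁻¹ *ᵥ Sum.elim x 0 = Sum.elim ((realMat R.toBlocks₁₁ᵀ)⁻¹ *ᵥ x) 0 := by
  obtain ⟨C, hC⟩ := exists_realMat_transpose_inv_eq hR h
  rw [hC, Matrix.fromBlocks_mulVec]
  simp

lemma inv_mulVec_comp_inl (hR : IsExpanding R) (h : Rᵀ.toBlocks₂₁ = 0)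
    (v : Fin r ⊕ Fin s → ℝ) :
    ((realMat R)⁻¹ *ᵥ v) ∘ Sum.inl = (realMat R.toBlocks₁₁)⁻¹ *ᵥ (v ∘ Sum.inl) := by
  obtain ⟨C, hC⟩ := exists_realMat_transpose_inv_eq hR h
  have h1 : (realMat R)⁻¹ = ((realMat Rᵀ)⁻¹)ᵀ := by
    rw [realMat_transpose, ← Matrix.transpose_nonsing_inv, Matrix.transpose_transpose]
  rw [mulVec_comp_inl, h1, hC, Matrix.fromBlocks_transpose, realMat_transpose,
    ← Matrix.transpose_nonsing_inv]
  simp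

lemma ifsMap_comp_inr (hR : IsExpanding R) (h : Rᵀ.toBlocks₂₁ = 0) (l : Fin r ⊕ Fin s → ℤ)
    (x : Fin r ⊕ Fin s → ℝ) :
    ifsMap Rᵀ l x ∘ Sum.inr = ifsMap Rᵀ.toBlocks₂₂ (l ∘ Sum.inr) (x ∘ Sum.inr) := by
  rw [ifsMap, inv_mulVec_comp_inr hR h]
  rfl

lemma ifsMap_comp_inl (hR : IsExpanding R) (h : Rᵀ.toBlocks₂₁ = 0) (b : Fin r ⊕ Fin s → ℤ)
    (x : Fin r ⊕ Fin s → ℝ) :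
    ifsMap R b x ∘ Sum.inl = ifsMap R.toBlocks₁₁ (b ∘ Sum.inl) (x ∘ Sum.inl) := by
  rw [ifsMap, inv_mulVec_comp_inl hR h]
  rfl

lemma tendsto_inv_pow_toBlocks₁₁ (hR : IsExpanding R) (h : Rᵀ.toBlocks₂₁ = 0) (x : Fin r → ℝ) :
    Tendsto (fun n : ℕ => (realMat R.toBlocks₁₁ᵀ)⁻¹ ^ n *ᵥ x) atTop (𝓝 0) := by
  have h1 : ∀ n : ℕ, (realMat Rᵀ)⁻¹ ^ n *ᵥ Sum.elim x 0 =
      Sum.elim ((realMat R.toBlocks₁₁ᵀ)⁻¹ ^ n *ᵥ x) 0 := by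
    intro n
    induction n with
    | zero => simp
    | succ n ih =>
      rw [pow_succ', ← Matrix.mulVec_mulVec, ih, inv_mulVec_elim_zero hR h, Matrix.mulVec_mulVec,
        ← pow_succ']
  have h2 := hR.tendsto_inv_pow_mulVec (Sum.elim x (0 : Fin s → ℝ))
  rw [tendsto_pi_nhds] at h2 ⊢
  intro i
  refine (h2 (Sum.inl i)).congr fun n => ?_
  rw [h1]
  rfl

lemma tendsto_inv_pow_toBlocks₂₂ (hR : IsExpanding R) (h : Rᵀ.toBlocks₂₁ = 0) (y : Fin s → ℝ) :
    Tendsto (fun n : ℕ => (realMat Rᵀ.toBlocks₂₂)⁻¹ ^ n *ᵥ y) atTop (𝓝 0) := by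
  have h1 : ∀ n : ℕ, ((realMat Rᵀ)⁻¹ ^ n *ᵥ Sum.elim (0 : Fin r → ℝ) y) ∘ Sum.inr =
      (realMat Rᵀ.toBlocks₂₂)⁻¹ ^ n *ᵥ y := by
    intro n
    induction n with
    | zero => simp
    | succ n ih =>
      rw [pow_succ', ← Matrix.mulVec_mulVec, inv_mulVec_comp_inr hR h, ih, Matrix.mulVec_mulVec,
        ← pow_succ']
  have h2 := hR.tendsto_inv_pow_mulVec (Sum.elim (0 : Fin r → ℝ) y)
  rw [tendsto_pi_nhds] at h2 ⊢
  intro i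
  refine (h2 (Sum.inr i)).congr fun n => ?_
  rw [← h1]
  rfl

end BlockTriangular

/-! ### The projection of μ_B is μ₁ -/

section ProjectedMeasure

variable {r s : ℕ} {R : Matrix (Fin r ⊕ Fin s) (Fin r ⊕ Fin s) ℤ}
  {B : Finset (Fin r ⊕ Fin s → ℤ)} {μ : Measure (Fin r ⊕ Fin s → ℝ)}

lemma measurable_comp_inl : Measurable fun t : Fin r ⊕ Fin s → ℝ => t ∘ Sum.inl :=
  measurable_pi_iff.2 fun i => measurable_pi_apply (Sum.inl i)

/-- The first coordinate intertwines τ_b with the map of its projected digit. Each projected digit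
is hit equally often, so averaging over B becomes uniform averaging over the projection. -/
lemma IsInvariantMeasure.map_comp_inl (hR : IsExpanding R) (h : Rᵀ.toBlocks₂₁ = 0)
    (hB : B.Nonempty) (hμ : IsInvariantMeasure R B μ)
    (hfib : ∀ ρ ∈ projFst B, ∀ ρ' ∈ projFst B, fibreCard B ρ = fibreCard B ρ') :
    IsInvariantMeasure R.toBlocks₁₁ (projFst B) (μ.map fun t => t ∘ Sum.inl) := by
  have := hμ.1
  refine ⟨Measure.isProbabilityMeasure_map measurable_comp_inl.aemeasurable, fun f hf => ?_⟩
  have hmap : ∀ g : (Fin r → ℝ) → ℂ, Continuous g →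
      ∫ x, g x ∂(μ.map fun t => t ∘ Sum.inl) = ∫ t, g (t ∘ Sum.inl) ∂μ := fun g hg =>
    integral_map measurable_comp_inl.aemeasurable hg.aestronglyMeasurable
  have hτ : ∀ ρ : Fin r → ℤ, Continuous (ifsMap R.toBlocks₁₁ ρ) := fun ρ => by
    unfold ifsMap
    exact Continuous.matrix_mulVec continuous_const (by fun_prop)
  have hinl : Continuous fun t : Fin r ⊕ Fin s → ℝ => t ∘ Sum.inl :=
    continuous_pi fun i => continuous_apply (Sum.inl i)
  have hmap' : ∀ ρ, ∫ x, f (ifsMap R.toBlocks₁₁ ρ x) ∂(μ.map fun t => t ∘ Sum.inl) =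
      ∫ t, f (ifsMap R.toBlocks₁₁ ρ (t ∘ Sum.inl)) ∂μ := fun ρ => hmap _ (hf.comp (hτ ρ))
  rw [hmap f hf, hμ.2 (fun t => f (t ∘ Sum.inl)) (hf.comp hinl)]
  simp only [ifsMap_comp_inl hR h, hmap']
  obtain ⟨b₀, hb₀⟩ := hB
  set c := fibreCard B (b₀ ∘ Sum.inl) with hc
  have hb₀' : b₀ ∘ Sum.inl ∈ projFst B := Finset.mem_image_of_mem _ hb₀
  have hmaps : ∀ b ∈ B, b ∘ Sum.inl ∈ projFst B := fun b hb => Finset.mem_image_of_mem _ hb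
  have hfc : ∀ ρ ∈ projFst B, (B.filter fun b => b ∘ Sum.inl = ρ).card = c := fun ρ hρ =>
    hfib ρ hρ _ hb₀'
  have hcard : B.card = (projFst B).card * c := by
    rw [Finset.card_eq_sum_card_fiberwise hmaps, Finset.sum_congr rfl hfc, Finset.sum_const,
      smul_eq_mul]
  have hc0 : (c : ℂ) ≠ 0 := by
    rw [Nat.cast_ne_zero]
    exact Finset.card_ne_zero_of_mem (Finset.mem_filter.2 ⟨hb₀, rfl⟩)
  rw [← Finset.sum_fiberwise_of_maps_to hmaps, hcard, Finset.sum_congr rfl fun ρ hρ => by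
    rw [Finset.sum_congr rfl fun b hb => by rw [(Finset.mem_filter.1 hb).2], Finset.sum_const,
      hfc ρ hρ, nsmul_eq_mul], ← Finset.mul_sum, ← mul_assoc]
  congr 1
  push_cast
  field_simp

lemma measurePreserving_comp_inl (hR : IsExpanding R) (h : Rᵀ.toBlocks₂₁ = 0)
    (hB : B.Nonempty)
    (hfib : ∀ ρ ∈ projFst B, ∀ ρ' ∈ projFst B, fibreCard B ρ = fibreCard B ρ') :
    MeasurePreserving (fun t : Fin r ⊕ Fin s → ℝ => t ∘ Sum.inl) (invariantMeasure R B)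
      (invariantMeasure R.toBlocks₁₁ (projFst B)) := by
  have h1 := (isInvariantMeasure_invariantMeasure R hR B hB).map_comp_inl hR h hB hfib
  -- The projected measure itself witnesses existence for A₁; uniqueness identifies it with the
  -- chosen one.
  have h2 : ∃ ν, IsInvariantMeasure R.toBlocks₁₁ (projFst B) ν := ⟨_, h1⟩
  refine ⟨measurable_comp_inl, ?_⟩
  have h3 : invariantMeasure R.toBlocks₁₁ (projFst B) = h2.choose := dif_pos h2
  rw [h3]
  exact h1.unique h2.choose_spec (tendsto_inv_pow_toBlocks₁₁ hR h)

end ProjectedMeasure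

end AffineIFS

namespace AffineIFS

/-! ### Words leading to ℝ^r × {y₀} and the null set of uncoded ones -/

section InvariantSubspace

variable {r s : ℕ} {R : Matrix (Fin r ⊕ Fin s) (Fin r ⊕ Fin s) ℤ}
  {B L : Finset (Fin r ⊕ Fin s → ℤ)} {y₀ : Fin s → ℝ} {m : Fin s → ℤ}

lemma realVec_injective {κ : Type*} : Function.Injective (realVec : (κ → ℤ) → κ → ℝ) :=
  fun _ _ h => funext fun i => Int.cast_injective (congrFun h i)

lemma realVec_eq_of_ifsMap_eq {ι : Type*} [Fintype ι] [DecidableEq ι] {M : Matrix ι ι ℤ}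
    (hM : IsUnit (realMat M)) {v : ι → ℤ} {y z : ι → ℝ} (h : ifsMap M v y = z) :
    realVec v = realMat M *ᵥ z - y := by
  rw [← h, ifsMap, Matrix.mulVec_mulVec,
    Matrix.mul_nonsing_inv _ ((Matrix.isUnit_iff_isUnit_det _).1 hM), Matrix.one_mulVec]
  abel

lemma ifsMap_comp_inr_sub (hR : IsExpanding R) (h : Rᵀ.toBlocks₂₁ = 0)
    (hm : ifsMap Rᵀ.toBlocks₂₂ m y₀ = y₀) {l : Fin r ⊕ Fin s → ℤ} (hl : l ∘ Sum.inr = m)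
    (x : Fin r ⊕ Fin s → ℝ) :
    ifsMap Rᵀ l x ∘ Sum.inr - y₀ = (realMat Rᵀ.toBlocks₂₂)⁻¹ *ᵥ (x ∘ Sum.inr - y₀) := by
  rw [ifsMap_comp_inr hR h, hl]
  conv_lhs => rw [← hm]
  rw [ifsMap, ifsMap, ← Matrix.mulVec_sub, add_sub_add_right_eq_sub]

lemma tendsto_sigmaPath_comp_inr (hR : IsExpanding R) (h : Rᵀ.toBlocks₂₁ = 0)
    (hm : ifsMap Rᵀ.toBlocks₂₂ m y₀ = y₀) {ω : ℕ → L}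
    (hω : ∀ᶠ n in atTop, (ω n : Fin r ⊕ Fin s → ℤ) ∘ Sum.inr = m) (x : Fin r ⊕ Fin s → ℝ) :
    Tendsto (fun n => sigmaPath R ω x n ∘ Sum.inr - y₀) atTop (𝓝 0) := by
  obtain ⟨n₀, hn₀⟩ := eventually_atTop.1 hω
  rw [← tendsto_add_atTop_iff_nat n₀]
  refine (tendsto_inv_pow_toBlocks₂₂ hR h (sigmaPath R ω x n₀ ∘ Sum.inr - y₀)).congr fun n => ?_
  induction n with
  | zero => simp
  | succ n ih =>
    rw [pow_succ', ← Matrix.mulVec_mulVec, ih, add_right_comm, sigmaPath,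
      ifsMap_comp_inr_sub hR h hm (hn₀ _ (by omega))]

/-- The distance to ℝ^r × {y₀} dominates each coordinate of z₂ - y₀ and is at most the Euclidean
norm of (0, z₂ - y₀). -/
lemma tendsto_infEDist_timesPoint_iff {α : Type*} {f : Filter α} {z : α → Fin r ⊕ Fin s → ℝ} :
    Tendsto (fun a => Metric.infEDist (WithLp.toLp 2 (z a) : EuclideanSpace ℝ (Fin r ⊕ Fin s))
      (WithLp.toLp 2 '' timesPoint Set.univ y₀)) f (𝓝 0) ↔
    Tendsto (fun a => z a ∘ Sum.inr - y₀) f (𝓝 0) := by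
  constructor
  · intro h
    rw [tendsto_pi_nhds]
    intro j
    rw [tendsto_iff_edist_tendsto_0]
    refine tendsto_of_tendsto_of_tendsto_of_le_of_le tendsto_const_nhds h (fun _ => zero_le)
      fun a => ?_
    refine Metric.le_infEDist.2 ?_
    rintro _ ⟨w, hw, rfl⟩
    rw [mem_timesPoint_univ] at hw
    have h1 := PiLp.lipschitzWith_ofLp 2 (fun _ : Fin r ⊕ Fin s => ℝ) (WithLp.toLp 2 (z a))
      (WithLp.toLp 2 w)
    rw [ENNReal.coe_one, one_mul] at h1
    refine (edist_le_pi_edist _ _ (Sum.inr j)).trans' ?_ |>.trans h1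
    rw [← hw, edist_dist, edist_dist, Real.dist_eq, Real.dist_eq]
    simp
  · intro h
    have h1 : Continuous fun y : Fin s → ℝ =>
        ‖(WithLp.toLp 2 (Sum.elim (0 : Fin r → ℝ) y) : EuclideanSpace ℝ (Fin r ⊕ Fin s))‖ₑ := by
      refine continuous_enorm.comp ((PiLp.continuous_toLp 2 _).comp (continuous_pi fun i => ?_))
      cases i with
      | inl i => exact continuous_const
      | inr i => exact continuous_apply i
    have h2 := (h1.tendsto 0).comp h
    have h3 : (WithLp.toLp 2 (Sum.elim (0 : Fin r → ℝ) (0 : Fin s → ℝ)) :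
        EuclideanSpace ℝ (Fin r ⊕ Fin s)) = 0 := by
      rw [Sum.elim_zero_zero]
      rfl
    rw [h3, enorm_zero] at h2
    refine tendsto_of_tendsto_of_tendsto_of_le_of_le tendsto_const_nhds h2 (fun _ => zero_le)
      fun a => ?_
    refine (Metric.infEDist_le_edist_of_mem (Set.mem_image_of_mem _
      (mem_timesPoint_univ.2 (Sum.elim_comp_inr (z a ∘ Sum.inl) y₀)))).trans ?_
    rw [edist_eq_enorm_sub, ← WithLp.toLp_sub]
    refine le_of_eq ?_
    simp only [Function.comp]
    congr 2
    ext i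
    cases i <;> simp

/-- The words which lead to `ℝ^r × {y₀}` are the ones whose second components are eventually
equal to `l₂⁰ = S₂y₀ - y₀`. -/
lemma wordsTo_timesPoint (hR : IsExpanding R) (h : Rᵀ.toBlocks₂₁ = 0)
    (hm : ifsMap Rᵀ.toBlocks₂₂ m y₀ = y₀) :
    wordsTo R L (timesPoint Set.univ y₀) =
      {ω | ∀ᶠ n in atTop, (ω n : Fin r ⊕ Fin s → ℤ) ∘ Sum.inr = m} := by
  ext ω
  simp only [wordsTo, tendsto_infEDist_timesPoint_iff, Set.mem_ofPred_eq]
  refine ⟨fun hω => ?_, fun hω => tendsto_sigmaPath_comp_inr hR h hm hω⟩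
  have hU := (isUnit_blocks hR h).2
  set y : ℕ → Fin s → ℝ := fun n => sigmaPath R ω 0 n ∘ Sum.inr with hy
  have h1 : Tendsto y atTop (𝓝 y₀) := by
    have := (hω 0).add_const y₀
    simpa [hy] using this
  -- The letters are recovered from the path as S₂y_{n+1} - y_n → S₂y₀ - y₀; a convergent sequence
  -- of integer vectors is eventually constant.
  have h2 : ∀ n, realVec ((ω n : Fin r ⊕ Fin s → ℤ) ∘ Sum.inr) =
      realMat Rᵀ.toBlocks₂₂ *ᵥ y (n + 1) - y n := fun n =>
    realVec_eq_of_ifsMap_eq hU (ifsMap_comp_inr hR h _ _).symm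
  have h3 : Tendsto (fun n => realVec ((ω n : Fin r ⊕ Fin s → ℤ) ∘ Sum.inr)) atTop
      (𝓝 (realVec m)) := by
    rw [realVec_eq_of_ifsMap_eq hU hm]
    simp only [h2]
    have hc : Continuous fun v => realMat Rᵀ.toBlocks₂₂ *ᵥ v :=
      Continuous.matrix_mulVec continuous_const continuous_id
    exact ((hc.tendsto y₀).comp (h1.comp (tendsto_add_atTop_nat 1))).sub h1
  rw [tendsto_pi_nhds] at h3
  have h4 := eventually_all.2 fun j => (Metric.tendsto_nhds.1 (h3 j)) 1 one_pos
  filter_upwards [h4] with n hn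
  funext j
  have h5 := hn j
  rw [realVec, realVec, Int.dist_cast_real, Int.dist_eq] at h5
  norm_cast at h5
  exact sub_eq_zero.1 (Int.abs_lt_one_iff.1 h5)

/-- In q = ω_n + Sq' both remainders have second component -y₀, which forces that of ω_n to be S₂y₀
- y₀. -/
lemma Codes.eventually_comp_inr_eq (hR : IsExpanding R) (h : Rᵀ.toBlocks₂₁ = 0)
    (hm : ifsMap Rᵀ.toBlocks₂₂ m y₀ = y₀) {Λ : Set (Fin r → ℝ)} {ω : ℕ → L}
    {p : Fin r ⊕ Fin s → ℝ} (hω : Codes R (timesPoint Λ (-y₀)) ω p) :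
    ∀ᶠ n in atTop, (ω n : Fin r ⊕ Fin s → ℤ) ∘ Sum.inr = m := by
  filter_upwards [hω.eventually_eq hR.isUnit_det_transpose] with n hn
  obtain ⟨_, ⟨x, -, rfl⟩, _, ⟨x', -, rfl⟩, hn⟩ := hn
  refine realVec_injective ?_
  rw [realVec_eq_of_ifsMap_eq (isUnit_blocks hR h).2 hm]
  have h1 := congrArg (fun v => v ∘ Sum.inr) hn
  change -y₀ = realVec (_ ∘ Sum.inr) + (realMat Rᵀ *ᵥ _) ∘ Sum.inr at h1
  rw [transpose_mulVec_comp_inr h, Sum.elim_comp_inr, Matrix.mulVec_neg] at h1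
  rw [sub_eq_add_neg, h1]
  abel

lemma measurableSet_setOf_forall_ge (n : ℕ) :
    MeasurableSet {ω : ℕ → L | ∀ k ≥ n, (ω k : Fin r ⊕ Fin s → ℤ) ∘ Sum.inr = m} := by
  have h1 : {ω : ℕ → L | ∀ k ≥ n, (ω k : Fin r ⊕ Fin s → ℤ) ∘ Sum.inr = m} =
      ⋂ k, ⋂ _ : n ≤ k, (fun ω : ℕ → L => ω k) ⁻¹'
        {l | (l : Fin r ⊕ Fin s → ℤ) ∘ Sum.inr = m} := by
    ext ω
    simp
  rw [h1]
  exact MeasurableSet.iInter fun k => MeasurableSet.iInter fun _ =>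
    measurable_pi_apply k (Set.toFinite _).measurableSet

/-- Let `E` be a set of words which is mapped into itself by the removal of first letters, and
whose words have first letters with the second component `l₂⁰`. A bound for the measure of `E`
at the points which lie `n` steps nearer to `ℝ^r × {y₀}` than `x` also holds at `x`. -/
lemma pathMeasure_le_of_forall (hR : IsExpanding R) (h : Rᵀ.toBlocks₂₁ = 0) (hB : B.Nonempty)
    (hRBL : IsHadamardTriple R B L) (hm : ifsMap Rᵀ.toBlocks₂₂ m y₀ = y₀) {E : Set (ℕ → L)}
    (hE : MeasurableSet E) (hE0 : ∀ ω ∈ E, (ω 0 : Fin r ⊕ Fin s → ℤ) ∘ Sum.inr = m)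
    (hEs : ∀ l ω, consWord l ω ∈ E → ω ∈ E) (n : ℕ) (x : Fin r ⊕ Fin s → ℝ) (ε : ℝ≥0∞)
    (hε : ∀ x' : Fin r ⊕ Fin s → ℝ, x' ∘ Sum.inr - y₀ =
      (realMat Rᵀ.toBlocks₂₂)⁻¹ ^ n *ᵥ (x ∘ Sum.inr - y₀) → pathMeasure R B L x' E ≤ ε) :
    pathMeasure R B L x E ≤ ε := by
  induction n generalizing x with
  | zero => exact hε x (by simp)
  | succ n ih =>
    rw [pathMeasure_apply hB hRBL x hE]
    calc ∑ l : L, ENNReal.ofReal (W B (ifsMap Rᵀ (l : Fin r ⊕ Fin s → ℤ) x)) *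
          pathMeasure R B L (ifsMap Rᵀ (l : Fin r ⊕ Fin s → ℤ) x) (consWord l ⁻¹' E)
        ≤ ∑ l : L, ENNReal.ofReal (W B (ifsMap Rᵀ (l : Fin r ⊕ Fin s → ℤ) x)) * ε := by
          refine Finset.sum_le_sum fun l _ => mul_le_mul_right ?_ _
          -- A letter with second component m brings x₂ - y₀ one factor S₂⁻¹ closer to 0, so the
          -- induction hypothesis applies; any other letter starts no word of E.
          by_cases hl : (l : Fin r ⊕ Fin s → ℤ) ∘ Sum.inr = m
          · refine (measure_mono fun ω hω => hEs l ω hω).trans (ih _ fun x' hx' => hε x' ?_)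
            rw [hx', ifsMap_comp_inr_sub hR h hm hl, Matrix.mulVec_mulVec, ← pow_succ]
          · have : consWord l ⁻¹' E = ∅ :=
              Set.eq_empty_of_forall_notMem fun ω hω => hl (hE0 _ hω)
            rw [this, measure_empty]
            exact zero_le
      _ = ε := by
          rw [← Finset.sum_mul, ← ENNReal.ofReal_sum_of_nonneg fun _ _ => W_nonneg _ _,
            sum_W_ifsMap R B L hB hRBL, ENNReal.ofReal_one, one_mul]

lemma timesPoint_orthogonal {Λ : Set (Fin r → ℝ)} {μ : Measure (Fin r ⊕ Fin s → ℝ)}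
    {μ₁ : Measure (Fin r → ℝ)}
    (hμ : MeasurePreserving (fun t : Fin r ⊕ Fin s → ℝ => t ∘ Sum.inl) μ μ₁)
    (hΛ : IsSpectrum μ₁ Λ) {q q' : Fin r ⊕ Fin s → ℝ} (hq : q ∈ timesPoint Λ y₀)
    (hq' : q' ∈ timesPoint Λ y₀) (hne : q ≠ q') : fourierTransform μ (q - q') = 0 := by
  obtain ⟨x, hx, rfl⟩ := hq
  obtain ⟨x', hx', rfl⟩ := hq'
  have h1 : (Sum.elim x y₀ - Sum.elim x' y₀ : Fin r ⊕ Fin s → ℝ) = Sum.elim (x - x') 0 := by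
    ext i
    cases i <;> simp
  rw [h1, ← fourierTransform_of_measurePreserving hμ]
  exact hΛ.fourierTransform_sub_eq_zero hx hx' fun h => hne (by rw [h])

/-- Keep only the layer n = 0 of the generated set, which is Γ itself, and apply
`IsSpectrum.le_tsum_fourierTransform`. -/
lemma le_tsum_generatedSet {Λ : Set (Fin r → ℝ)} {μ : Measure (Fin r ⊕ Fin s → ℝ)}
    {μ₁ : Measure (Fin r → ℝ)} [IsProbabilityMeasure μ] [IsProbabilityMeasure μ₁]
    (hμ : MeasurePreserving (fun t : Fin r ⊕ Fin s → ℝ => t ∘ Sum.inl) μ μ₁)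
    (hΛ : IsSpectrum μ₁ Λ) (x : Fin r ⊕ Fin s → ℝ) :
    ‖fourierTransform μ (Sum.elim 0 (x ∘ Sum.inr - y₀))‖ₑ ^ 2 ≤
      ∑' p : generatedSet R L (timesPoint Λ (-y₀)),
        ‖fourierTransform μ (x + (p : Fin r ⊕ Fin s → ℝ))‖ₑ ^ 2 := by
  refine (hΛ.le_tsum_fourierTransform hμ (x ∘ Sum.inl) (x ∘ Sum.inr - y₀)).trans ?_
  refine le_trans (le_of_eq ?_) (ENNReal.tsum_mono_subtype
    (fun p => ‖fourierTransform μ (x + p)‖ₑ ^ 2) (subset_generatedSet (R := R) (L := L)))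
  have hinj : Set.InjOn (fun p : Fin r → ℝ => Sum.elim p (-y₀)) Λ := fun p _ q _ hpq =>
    congrArg (fun v => v ∘ Sum.inl) hpq
  refine Eq.trans ?_ (tsum_image (fun p => ‖fourierTransform μ (x + p)‖ₑ ^ 2) hinj).symm
  refine tsum_congr fun p => ?_
  congr 3
  ext i
  cases i <;> simp [sub_eq_add_neg]

theorem isSpectralSet_timesPoint (hR : IsExpanding R) (h : Rᵀ.toBlocks₂₁ = 0) (hB : B.Nonempty)
    (hRBL : IsHadamardTriple R B L) (hinv : IsInvariantSet R B L (timesPoint Set.univ y₀))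
    (hm : ifsMap Rᵀ.toBlocks₂₂ m y₀ = y₀)
    (hfib : ∀ ρ ∈ projFst B, ∀ ρ' ∈ projFst B, fibreCard B ρ = fibreCard B ρ')
    {Λ : Set (Fin r → ℝ)}
    (hΛ : IsSpectrum (invariantMeasure R.toBlocks₁₁ (projFst B)) Λ)
    (hΓ : timesPoint Λ (-y₀) ⊆ (fun v => realMat Rᵀ *ᵥ v) '' timesPoint Λ (-y₀) +
      realVec '' (L : Set (Fin r ⊕ Fin s → ℤ)))
    (hper : ∀ p ∈ Λ, IsSPeriod R (W B) (Sum.elim p (-y₀))) :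
    IsSpectralSet R B L (timesPoint Set.univ y₀) (generatedSet R L (timesPoint Λ (-y₀))) := by
  have hμ := measurePreserving_comp_inl hR h hB hfib
  have hp : IsProbabilityMeasure (invariantMeasure R B) :=
    (isInvariantMeasure_invariantMeasure R hR B hB).1
  have hp₁ : IsProbabilityMeasure (invariantMeasure R.toBlocks₁₁ (projFst B)) :=
    hμ.map_eq ▸ Measure.isProbabilityMeasure_map hμ.measurable.aemeasurable
  have hpP := fun x => (isPathMeasure_pathMeasure R B L hB hRBL x).1
  have hper' : ∀ q ∈ timesPoint Λ (-y₀), IsSPeriod R (W B) q := by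
    rintro _ ⟨p, hp, rfl⟩
    exact hper p hp
  have hΓc : (timesPoint Λ (-y₀)).Countable := hΛ.countable.image _
  set C : Set (ℕ → L) := {ω | ∃ p, Codes R (timesPoint Λ (-y₀)) ω p} with hC
  have hCm : MeasurableSet C := (countable_setOf_codes hR hB hRBL hper' hΓc).measurableSet
  have hPC : ∀ x, pathMeasure R B L x C = _ := pathMeasure_setOf_codes hR hB hRBL hper'
    (fun q hq q' hq' => timesPoint_orthogonal hμ hΛ hq hq') hΓ hΓc
  -- The uncoded words of N(F), sorted by the index from which the second component is m; each `E n`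
  -- is shown to be null from every starting point.
  set E : ℕ → Set (ℕ → L) := fun n =>
    {ω | ∀ k ≥ n, (ω k : Fin r ⊕ Fin s → ℤ) ∘ Sum.inr = m} ∩ Cᶜ with hE
  have hEm : ∀ n, MeasurableSet (E n) := fun n => (measurableSet_setOf_forall_ge n).inter hCm.compl
  have hcons : ∀ l ω, ω ∈ C → consWord l ω ∈ C := fun l ω ⟨p, hp⟩ => ⟨_, hp.consWord l⟩
  have hnull : ∀ n x, pathMeasure R B L x (E n) = 0 := by
    intro n
    induction n with
    | zero =>
      intro x
      -- Bound `E 0` by the complement of C at points n steps closer to F, and carry the bound back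
      -- to x. `E 0` is stable under deleting a first letter because C is stable under adding one.
      have h1 : ∀ n : ℕ, pathMeasure R B L x (E 0) ≤ 1 - ‖fourierTransform (invariantMeasure R B)
          (Sum.elim 0 ((realMat Rᵀ.toBlocks₂₂)⁻¹ ^ n *ᵥ (x ∘ Sum.inr - y₀)))‖ₑ ^ 2 := by
        intro n
        refine pathMeasure_le_of_forall hR h hB hRBL hm (hEm 0) (fun ω hω => hω.1 0 le_rfl)
          (fun l ω hω => ⟨fun k _ => hω.1 (k + 1) (Nat.zero_le _),
            fun hωC => hω.2 (hcons l ω hωC)⟩) n x _ fun x' hx' => ?_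
        refine (measure_mono Set.inter_subset_right).trans ?_
        rw [prob_compl_eq_one_sub hCm, ← hx', hPC]
        exact tsub_le_tsub_left (le_tsum_generatedSet hμ hΛ x') _
      have h2 : Continuous fun y : Fin s → ℝ =>
          ‖fourierTransform (invariantMeasure R B) (Sum.elim 0 y)‖ₑ ^ 2 := by
        refine (ENNReal.continuous_pow 2).comp (continuous_enorm.comp
          ((continuous_fourierTransform _).comp (continuous_pi fun i => ?_)))
        cases i with
        | inl i => exact continuous_const
        | inr i => exact continuous_apply i
      have h3 := (h2.tendsto 0).comp (tendsto_inv_pow_toBlocks₂₂ hR h (x ∘ Sum.inr - y₀))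
      rw [Sum.elim_zero_zero, fourierTransform_zero, enorm_one, one_pow] at h3
      have h4 := ENNReal.Tendsto.sub (tendsto_const_nhds (x := (1 : ℝ≥0∞))) h3
        (Or.inl ENNReal.one_ne_top)
      rw [tsub_self] at h4
      exact le_antisymm (ge_of_tendsto' h4 h1) zero_le
    | succ n ih =>
      intro x
      -- Deleting the first letter takes `E (n + 1)` into `E n`, which is null from every point.
      rw [pathMeasure_apply hB hRBL x (hEm _)]
      refine Finset.sum_eq_zero fun l _ => ?_
      rw [measure_mono_null _ (ih _), mul_zero]
      exact fun ω hω => ⟨fun k hk => hω.1 (k + 1) (by omega), fun hωC => hω.2 (hcons l ω hωC)⟩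
  refine ⟨hinv, fun x => ?_⟩
  rw [← hPC, wordsTo_timesPoint hR h hm]
  refine le_antisymm ?_ (measure_mono fun ω ⟨p, hp⟩ => hp.eventually_comp_inr_eq hR h hm)
  calc _ ≤ pathMeasure R B L x (C ∪ ⋃ n, E n) := by
        refine measure_mono fun ω hω => ?_
        by_cases hωC : ω ∈ C
        · exact Or.inl hωC
        · obtain ⟨n, hn⟩ := eventually_atTop.1 hω
          exact Or.inr (Set.mem_iUnion.2 ⟨n, hn, hωC⟩)
    _ ≤ pathMeasure R B L x C + pathMeasure R B L x (⋃ n, E n) := measure_union_le _ _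
    _ = pathMeasure R B L x C := by rw [measure_iUnion_null fun n => hnull n x, add_zero]

end InvariantSubspace

end AffineIFS

/-! ### The theorem -/

theorem theorem4 {r s : ℕ} (R : Matrix (Fin r ⊕ Fin s) (Fin r ⊕ Fin s) ℤ)
    (B L : Finset (Fin r ⊕ Fin s → ℤ))
    (hR : AffineIFS.IsExpanding R) (hB : 0 ∈ B) (hL : 0 ∈ L)
    (hRBL : AffineIFS.IsHadamardTriple R B L)
    (y₀ : Fin s → ℝ)
    (hinv : AffineIFS.IsInvariantSet R B L (AffineIFS.timesPoint Set.univ y₀)) :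
    (∀ v ∈ AffineIFS.timesPoint (r := r) (s := s) Set.univ 0,
      AffineIFS.realMat Rᵀ *ᵥ v ∈ AffineIFS.timesPoint (r := r) (s := s) Set.univ 0) ∧
    (∃ l ∈ L, AffineIFS.ifsMap Rᵀ.toBlocks₂₂ (l ∘ Sum.inr) y₀ = y₀) ∧
    ∀ l ∈ L, AffineIFS.ifsMap Rᵀ.toBlocks₂₂ (l ∘ Sum.inr) y₀ = y₀ →
      AffineIFS.NoOverlap R.toBlocks₁₁ (AffineIFS.projFst B) →
      (∀ ρ ∈ AffineIFS.projFst B, ∀ ρ' ∈ AffineIFS.projFst B,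
        AffineIFS.fibreCard B ρ = AffineIFS.fibreCard B ρ') →
      ∀ Λ₁ : Set (Fin r → ℝ),
        AffineIFS.IsSpectrum
          (AffineIFS.invariantMeasure R.toBlocks₁₁ (AffineIFS.projFst B)) Λ₁ →
        AffineIFS.timesPoint Λ₁ (-y₀) ⊆
          (fun v => AffineIFS.realMat Rᵀ *ᵥ v) '' AffineIFS.timesPoint Λ₁ (-y₀) +
            AffineIFS.realVec '' (L : Set (Fin r ⊕ Fin s → ℤ)) →
        (∀ p ∈ Λ₁, AffineIFS.IsSPeriod R (AffineIFS.W B) (Sum.elim p (-y₀))) →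
        AffineIFS.IsHadamardTriple R.toBlocks₁₁ (AffineIFS.projFst B)
          (AffineIFS.rowSet L (l ∘ Sum.inr)) →
        AffineIFS.IsSpectralSet R B L (AffineIFS.timesPoint Set.univ y₀)
          (AffineIFS.generatedSet R L (AffineIFS.timesPoint Λ₁ (-y₀))) := by
  have hB' : B.Nonempty := ⟨0, hB⟩
  have h := AffineIFS.toBlocks₂₁_eq_zero hR (AffineIFS.toBlocks₂₁_inv_eq_zero hB' hRBL hinv)
  refine ⟨fun v hv => ?_, ?_, ?_⟩
  · rw [AffineIFS.mem_timesPoint_univ] at hv ⊢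
    rw [AffineIFS.transpose_mulVec_comp_inr h, hv, Matrix.mulVec_zero]
  -- Any point of ℝ^r × {y₀} would do: a letter keeping it in the set fixes y₀ in the second
  -- coordinate.
  · obtain ⟨l, hl, hly⟩ := hinv.exists_ifsMap_mem hB' hRBL (x := Sum.elim 0 y₀) ⟨0, trivial, rfl⟩
    rw [AffineIFS.mem_timesPoint_univ, AffineIFS.ifsMap_comp_inr hR h, Sum.elim_comp_inr] at hly
    exact ⟨l, hl, hly⟩
  · intro l _ hly _ hfib Λ₁ hΛ₁ hΓ hper _
    exact AffineIFS.isSpectralSet_timesPoint hR h hB' hRBL hinv hly hfib hΛ₁ hΓ hper
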